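/- **Two dimensional comparison theorem.** Let $\Omega\subset\mathbb R^2$ be a polygonal domain (open, connected) with a finite conforming triangulation $\mathcal T$ such that $\partial\Omega$ is a union of edges of $\mathcal T$; let $\Gamma_D\subseteq\partial\Omega$ be a union of closed boundary edges of positive length, and $\Gamma_N=\partial\Omega\setminus\Gamma_D$. Let $\mathcal V$ be the space of functions on $\overline\Omega$ that are affine on each (closed) triangle $T\in\mathcal T$ and vanish on $\Gamma_D$, and let $\mathcal V^+=\{v\in\mathcal V: v\ge 0\}$. Assume that there are $0<t_{\min}\le t_{\max}<\pi/2$ such that all interior angles of all $T\in\mathcal T$ lie in $[t_{\min},t_{\max}]$; put $c_{\min}=\cos t_{\max}$. For $T\in\mathcal T$ with angles $\theta_1,\theta_2,\theta_3$, vertices $a_1,a_2,a_3$ and area $|T|$, put $$c_T=\min_i\cos\theta_i,\qquad s_T=\max_i\sin\theta_i,\qquad r_T=\min_{i,j}\frac{\sin\theta_i}{\sin\theta_j},\qquad \delta_T(\phi)=\max_{i,j}|\phi(a_i)-\phi(a_j)|.$$ *Coefficients.* Let $A:\Omega\times\mathbb R\times\mathbb R^2\to\mathbb R$, $a(x,\eta,\xi)=A(x,\eta,\xi)\xi$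 and $b:\Omega\times\mathbb R\to\mathbb R$, where $a$ and $b$ are measurable in $x$ for every $(\eta,\xi)$, respectively $\eta$, and, for a.e. $x\in\Omega$, $C^1$ in $(\eta,\xi)$, respectively $\eta$. Assume that there are constants $\gamma_a>0$, $K_\eta>0$, $B_\eta\ge0$ such that, for a.e. $x\in\Omega$ and all $\eta\in\mathbb R$, $\xi,\zeta\in\mathbb R^2$, $$\sum_{i,j}\frac{\partial a_i}{\partial\xi_j}(x,\eta,\xi)\zeta_i\zeta_j\ge\gamma_a|\zeta|^2,\qquad \left|\frac{\partial A}{\partial\eta}(x,\eta,\xi)\right|\le K_\eta,\qquad 0\le\frac{\partial b}{\partial\eta}(x,\eta)\le B_\eta$$ (in particular $A$ is differentiable in $\eta$). Assume that $$A(x,\eta,\xi)=A_0(x,\eta)+A_1(x,\eta)f(|\xi|)+A_2(x)g(|\xi|),$$ with constants $\lambda_0>0$, $\Lambda_1,\Lambda_2\ge0$ such that $A_0(x,\eta)\ge\lambda_0$, $0\le A_1(x,\eta)\le\Lambda_1$, $0\le A_2(x)\le\Lambda_2$ for a.e. $x\in\Omega$ and all $\eta\in\mathbb R$; that $f,g\ge0$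 on $[0,\infty)$, $f$ and $g$ are differentiable on $(0,\infty)$, and $s|f'(s)|\le C_f$, $s|g'(s)|\le C_g$ for all $s\geq 0$ (the bounds at $s=0$ reading $0\le C_f$, $0\le C_g$); and that $$\lambda_0c_{\min}-\Lambda_1C_f-\Lambda_2C_g>0.$$ *Discrete problem.* Let $\psi$ be bounded and measurable on $\Gamma_N$. For $u,v\in\mathcal V$ put $$R(u;v)=\int_\Omega\big(a(x,u,\nabla u)\cdot\nabla v+b(x,u)v\big)\,dx-\int_{\Gamma_N}\psi v\,ds.$$ Call $u\in\mathcal V$ a discrete subsolution (supersolution) if for all $v\in\mathcal V^+$ the integrand over $\Omega$ is integrable and $R(u;v)\le0$ ($R(u;v)\ge0$), and a discrete solution if for all $v\in\mathcal V$ the integrand over $\Omega$ is integrable and $R(u;v)=0$. With $p_T^*=\min\{\lambda_0c_T-\Lambda_1C_f-\Lambda_2C_g,\ \gamma_a/r_T\}$, consider for $u\in\mathcal V$ the condition $$\min_{T\in\mathcal T}\left\{p_T^*-\delta_T(u)\frac{7K_\eta(1+r_T^{-1})}{6}-\frac{7B_\eta|T|s_T}{3}\right\}>0.\tag{M}$$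 1. If $u_1$ is a discrete subsolution, $u_2$ is a discrete supersolution and $u=u_2$ satisfies (M), then $u_1\le u_2$ in $\Omega$. 2. If $u$ is a discrete solution that satisfies (M), then it is the only discrete solution: every discrete solution $u'$ equals $u$ in $\Omega$. -/

import Mathlib

open MeasureTheory Set

noncomputable section

namespace P1Comparison

/-- The Euclidean plane. -/
abbrev Plane := EuclideanSpace ℝ (Fin 2)

/-! ### Geometry of a single triangle -/

/-- The interior angle of the triangle `T` at its vertex number `i`. -/
def angle (T : Affine.Triangle ℝ Plane) (i : Fin 3) : ℝ :=
  EuclideanGeometry.angle (T.points (i + 1)) (T.points i) (T.points (i + 2))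

/-- The area of `T`. -/
def area (T : Affine.Triangle ℝ Plane) : ℝ := volume.real T.closedInterior

/-- `c_T`, the smallest cosine of an angle of `T`. -/
def cosMin (T : Affine.Triangle ℝ Plane) : ℝ :=
  Finset.univ.inf' Finset.univ_nonempty fun i : Fin 3 => Real.cos (angle T i)

/-- `s_T`, the largest sine of an angle of `T`. -/
def sinMax (T : Affine.Triangle ℝ Plane) : ℝ :=
  Finset.univ.sup' Finset.univ_nonempty fun i : Fin 3 => Real.sin (angle T i)

/-- `r_T`, the smallest ratio of the sines of two angles of `T`. -/
def sinRatio (T : Affine.Triangle ℝ Plane) : ℝ :=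
  Finset.univ.inf' Finset.univ_nonempty
    fun p : Fin 3 × Fin 3 => Real.sin (angle T p.1) / Real.sin (angle T p.2)

/-- `δ_T(φ)`, the largest difference between two vertex values of `φ` on `T`. -/
def vertexVariation (T : Affine.Triangle ℝ Plane) (φ : Plane → ℝ) : ℝ :=
  Finset.univ.sup' Finset.univ_nonempty
    fun p : Fin 3 × Fin 3 => |φ (T.points p.1) - φ (T.points p.2)|

/-! ### The mesh and the finite element space -/

/-- The (closed) edges of triangles of `𝒯` that lie on the boundary of `Ω`. -/
def boundaryEdges (Ω : Set Plane) (𝒯 : Finset (Affine.Triangle ℝ Plane)) : Set (Set Plane) :=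
  {e | e ⊆ frontier Ω ∧
    ∃ T ∈ 𝒯, ∃ i j : Fin 3, i ≠ j ∧ e = segment ℝ (T.points i) (T.points j)}

/-- `𝒯` is a conforming triangulation of the polygonal domain `Ω`: the closed triangles cover the
closure of `Ω`, two of them meet exactly in the simplex spanned by their common vertices (nothing,
a vertex, an edge), and the boundary of `Ω` consists of edges of the mesh. -/
structure IsTriangulation (Ω : Set Plane) (𝒯 : Finset (Affine.Triangle ℝ Plane)) : Prop where
  isOpen : IsOpen Ω
  isConnected : IsConnected Ω
  cover : closure Ω = ⋃ T ∈ 𝒯, T.closedInterior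
  conforming : ∀ T ∈ 𝒯, ∀ T' ∈ 𝒯,
    T.closedInterior ∩ T'.closedInterior = convexHull ℝ (range T.points ∩ range T'.points)
  boundary : frontier Ω = ⋃₀ boundaryEdges Ω 𝒯

/-- `ΓD` is a part of the boundary of positive length that is captured by the mesh, that is, a
union of closed boundary edges. -/
structure IsDirichletPart (Ω : Set Plane) (𝒯 : Finset (Affine.Triangle ℝ Plane))
    (ΓD : Set Plane) : Prop where
  captured : ∃ ℰ ⊆ boundaryEdges Ω 𝒯, ΓD = ⋃₀ ℰ
  pos : 0 < μH[1] ΓD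

/-- All interior angles of all triangles lie between `tmin` and `tmax`, where
`0 < tmin ≤ tmax < π / 2`. -/
structure MeshRegular (𝒯 : Finset (Affine.Triangle ℝ Plane)) (tmin tmax : ℝ) : Prop where
  tmin_pos : 0 < tmin
  tmin_le_tmax : tmin ≤ tmax
  tmax_lt : tmax < Real.pi / 2
  angles : ∀ T ∈ 𝒯, ∀ i, tmin ≤ angle T i ∧ angle T i ≤ tmax

/-- The `P1` Lagrange finite element space: functions that are affine on every closed triangle
(hence continuous on the closure of `Ω`) and vanish on `ΓD`.
Values outside the closure of `Ω` are irrelevant. -/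
def FESpace (𝒯 : Finset (Affine.Triangle ℝ Plane)) (ΓD : Set Plane) : Set (Plane → ℝ) :=
  {φ | (∀ T ∈ 𝒯, ∃ L : Plane →ᵃ[ℝ] ℝ, ∀ x ∈ T.closedInterior, φ x = L x) ∧ ∀ x ∈ ΓD, φ x = 0}

/-- The nonnegative functions of the finite element space. -/
def FESpaceNonneg (Ω : Set Plane) (𝒯 : Finset (Affine.Triangle ℝ Plane)) (ΓD : Set Plane) :
    Set (Plane → ℝ) :=
  {φ | φ ∈ FESpace 𝒯 ΓD ∧ ∀ x ∈ Ω, 0 ≤ φ x}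

/-! ### The discrete problem -/

/-- `a(x, η, ξ) = A(x, η, ξ) ξ`. -/
def flux (A : Plane → ℝ → Plane → ℝ) (x : Plane) (η : ℝ) (ξ : Plane) : Plane := A x η ξ • ξ

/-- `a(x, u, ∇u) · ∇v + b(x, u) v`. The gradient of a function of the finite element space exists
at every point of `Ω` off the edges of the mesh, hence almost everywhere in `Ω`. -/
def weakIntegrand (A : Plane → ℝ → Plane → ℝ) (b : Plane → ℝ → ℝ) (u v : Plane → ℝ)
    (x : Plane) : ℝ :=
  inner ℝ (flux A x (u x) (gradient u x)) (gradient v x) + b x (u x) * v x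

/-- The left side of the weak form minus the right side; the Neumann part of the boundary is
`frontier Ω \ ΓD`, and `ds` is the one-dimensional Hausdorff measure, that is, arc length. -/
def residual (Ω ΓD : Set Plane) (A : Plane → ℝ → Plane → ℝ) (b : Plane → ℝ → ℝ)
    (ψ : Plane → ℝ) (u v : Plane → ℝ) : ℝ :=
  (∫ x in Ω, weakIntegrand A b u v x) - ∫ x in frontier Ω \ ΓD, ψ x * v x ∂μH[1]

/-- Discrete subsolutions (the integrals of the definition are required to exist). -/
def IsSubsolution (Ω : Set Plane) (𝒯 : Finset (Affine.Triangle ℝ Plane)) (ΓD : Set Plane)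
    (A : Plane → ℝ → Plane → ℝ) (b : Plane → ℝ → ℝ) (ψ : Plane → ℝ) (u : Plane → ℝ) : Prop :=
  u ∈ FESpace 𝒯 ΓD ∧ ∀ v ∈ FESpaceNonneg Ω 𝒯 ΓD,
    IntegrableOn (weakIntegrand A b u v) Ω ∧ residual Ω ΓD A b ψ u v ≤ 0

/-- Discrete supersolutions (the integrals of the definition are required to exist). -/
def IsSupersolution (Ω : Set Plane) (𝒯 : Finset (Affine.Triangle ℝ Plane)) (ΓD : Set Plane)
    (A : Plane → ℝ → Plane → ℝ) (b : Plane → ℝ → ℝ) (ψ : Plane → ℝ) (u : Plane → ℝ) : Prop :=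
  u ∈ FESpace 𝒯 ΓD ∧ ∀ v ∈ FESpaceNonneg Ω 𝒯 ΓD,
    IntegrableOn (weakIntegrand A b u v) Ω ∧ 0 ≤ residual Ω ΓD A b ψ u v

/-- Discrete solutions (the integrals of the definition are required to exist). -/
def IsDiscreteSolution (Ω : Set Plane) (𝒯 : Finset (Affine.Triangle ℝ Plane)) (ΓD : Set Plane)
    (A : Plane → ℝ → Plane → ℝ) (b : Plane → ℝ → ℝ) (ψ : Plane → ℝ) (u : Plane → ℝ) : Prop :=
  u ∈ FESpace 𝒯 ΓD ∧ ∀ v ∈ FESpace 𝒯 ΓD,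
    IntegrableOn (weakIntegrand A b u v) Ω ∧ residual Ω ΓD A b ψ u v = 0

/-! ### Assumptions on the coefficients -/

/-- The general assumptions on `a(x, η, ξ) = A(x, η, ξ) ξ` and `b`: Carathéodory functions, `C¹` in
`(η, ξ)` and in `η`; ellipticity with constant `γa`; `|∂A/∂η| ≤ Kη`; `0 ≤ ∂b/∂η ≤ Bη`. -/
structure CoefficientAssumptions (Ω : Set Plane) (A : Plane → ℝ → Plane → ℝ)
    (b : Plane → ℝ → ℝ) (γa Kη Bη : ℝ) : Prop where
  γa_pos : 0 < γa
  Kη_pos : 0 < Kη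
  Bη_nonneg : 0 ≤ Bη
  flux_measurable : ∀ η ξ, AEMeasurable (fun x => flux A x η ξ) (volume.restrict Ω)
  b_measurable : ∀ η, AEMeasurable (fun x => b x η) (volume.restrict Ω)
  flux_contDiff : ∀ᵐ x ∂volume.restrict Ω, ContDiff ℝ 1 fun p : ℝ × Plane => flux A x p.1 p.2
  b_contDiff : ∀ᵐ x ∂volume.restrict Ω, ContDiff ℝ 1 (b x)
  elliptic : ∀ᵐ x ∂volume.restrict Ω, ∀ (η : ℝ) (ξ ζ : Plane),
    γa * ‖ζ‖ ^ 2 ≤ inner ℝ (fderiv ℝ (flux A x η) ξ ζ) ζ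
  A_deriv : ∀ᵐ x ∂volume.restrict Ω, ∀ (η : ℝ) (ξ : Plane),
    DifferentiableAt ℝ (fun t => A x t ξ) η ∧ |deriv (fun t => A x t ξ) η| ≤ Kη
  b_deriv : ∀ᵐ x ∂volume.restrict Ω, ∀ η : ℝ, 0 ≤ deriv (b x) η ∧ deriv (b x) η ≤ Bη

/-- The structure `A(x, η, ξ) = A₀(x, η) + A₁(x, η) f(|ξ|) + A₂(x) g(|ξ|)` of the diffusion
coefficient with `A₀ ≥ lam₀ > 0`, `0 ≤ A₁ ≤ Λ₁`, `0 ≤ A₂ ≤ Λ₂`, nonnegative `f` and `g` on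
`[0, ∞)`, `s |f'(s)| ≤ Cf` and `s |g'(s)| ≤ Cg`. As the last two bounds carry no information on the
derivatives at `s = 0`, differentiability is only asked for at `s > 0`. -/
structure DiffusionForm (Ω : Set Plane) (A : Plane → ℝ → Plane → ℝ)
    (A₀ A₁ : Plane → ℝ → ℝ) (A₂ : Plane → ℝ) (f g : ℝ → ℝ)
    (lam₀ Λ₁ Λ₂ Cf Cg : ℝ) : Prop where
  decomp : ∀ x ∈ Ω, ∀ (η : ℝ) (ξ : Plane),
    A x η ξ = A₀ x η + A₁ x η * f ‖ξ‖ + A₂ x * g ‖ξ‖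
  lam₀_pos : 0 < lam₀
  Λ₁_nonneg : 0 ≤ Λ₁
  Λ₂_nonneg : 0 ≤ Λ₂
  A₀_bound : ∀ᵐ x ∂volume.restrict Ω, ∀ η : ℝ, lam₀ ≤ A₀ x η
  A₁_bound : ∀ᵐ x ∂volume.restrict Ω, ∀ η : ℝ, 0 ≤ A₁ x η ∧ A₁ x η ≤ Λ₁
  A₂_bound : ∀ᵐ x ∂volume.restrict Ω, 0 ≤ A₂ x ∧ A₂ x ≤ Λ₂
  f_nonneg : ∀ s, 0 ≤ s → 0 ≤ f s
  g_nonneg : ∀ s, 0 ≤ s → 0 ≤ g s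
  f_differentiable : ∀ s, 0 < s → DifferentiableAt ℝ f s
  g_differentiable : ∀ s, 0 < s → DifferentiableAt ℝ g s
  f_deriv : ∀ s, 0 ≤ s → s * |deriv f s| ≤ Cf
  g_deriv : ∀ s, 0 ≤ s → s * |deriv g s| ≤ Cg

/-! ### The mesh condition -/

/-- `p*_T = min {lam₀ c_T - Λ₁ Cf - Λ₂ Cg, γa / r_T}`. -/
def pStar (lam₀ Λ₁ Λ₂ Cf Cg γa : ℝ) (T : Affine.Triangle ℝ Plane) : ℝ :=
  min (lam₀ * cosMin T - Λ₁ * Cf - Λ₂ * Cg) (γa / sinRatio T)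

/-- The minimum over the (finitely many) triangles `T` of
`p*_T - δ_T(u) · 7 Kη (1 + r_T⁻¹) / 6 - 7 Bη |T| s_T / 3` is positive. -/
def MeshCondition (𝒯 : Finset (Affine.Triangle ℝ Plane)) (lam₀ Λ₁ Λ₂ Cf Cg γa Kη Bη : ℝ)
    (u : Plane → ℝ) : Prop :=
  ∀ T ∈ 𝒯, 0 < pStar lam₀ Λ₁ Λ₂ Cf Cg γa T
    - vertexVariation T u * (7 * Kη * (1 + (sinRatio T)⁻¹) / 6)
    - 7 * Bη * area T * sinMax T / 3

end P1Comparison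

end

open P1Comparison

/-!
Test the difference of the two weak inequalities with the nodal interpolant `v` of the indicator
function of `{u₂ < u₁}`. On a triangle where `v` is constant only the reaction terms remain, and
monotonicity of `b` makes their difference nonnegative. On any other triangle exactly one vertex
lies on its side of the sign change, and `u₁ - u₂` and `v` jump in the same direction along both
edges at that vertex. As the angles are acute, this makes the flux difference tested with `∇v`
positive; it is proportional to the jumps of `u₁ - u₂`, which also bound `|u₁ - u₂|` on the
triangle, so the mesh condition lets it absorb the terms caused by the dependence of `A` and `b` on
`η`. The difference of the integrands is thus nonnegative, and positive on every triangle where `v`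
is not constant; since its integral is not positive, there is no such triangle. Hence `v` is
constant on the connected set `Ω`, and it vanishes because it does so on `ΓD`.
-/

namespace P1Comparison

/-! ### Functions that are affine on a set -/

section AffineOn

/-- `φ` agrees on `s` with an affine function on the whole space; this is the local form of the
functions of the finite element space. -/
def AffineOn {E : Type*} [AddCommGroup E] [Module ℝ E] (φ : E → ℝ) (s : Set E) : Prop :=
  ∃ L : E →ᵃ[ℝ] ℝ, ∀ x ∈ s, φ x = L x

section Module

variable {E : Type*} [AddCommGroup E] [Module ℝ E] {φ ψ : E → ℝ} {s : Set E} {t : Set ℝ}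

lemma AffineOn.mono (hφ : AffineOn φ s) {r : Set E} (hrs : r ⊆ s) : AffineOn φ r :=
  let ⟨L, hL⟩ := hφ
  ⟨L, fun x hx => hL x (hrs hx)⟩

lemma AffineOn.sub (hφ : AffineOn φ s) (hψ : AffineOn ψ s) : AffineOn (φ - ψ) s :=
  let ⟨L, hL⟩ := hφ
  let ⟨M, hM⟩ := hψ
  ⟨L - M, fun x hx => by simp [hL x hx, hM x hx]⟩

lemma AffineOn.mapsTo_convexHull (hφ : AffineOn φ (convexHull ℝ s)) (ht : Convex ℝ t)
    (h : MapsTo φ s t) : MapsTo φ (convexHull ℝ s) t := by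
  obtain ⟨L, hL⟩ := hφ
  have hsub : convexHull ℝ s ⊆ L ⁻¹' t :=
    convexHull_min (fun x hx => by simpa [← hL x (subset_convexHull ℝ s hx)] using h hx)
      (ht.affine_preimage L)
  exact fun x hx => (hL x hx).symm ▸ hsub hx

lemma AffineOn.mapsTo_closedInterior {n : ℕ} {T : Affine.Simplex ℝ E n}
    (hφ : AffineOn φ T.closedInterior) (ht : Convex ℝ t) (h : ∀ i, φ (T.points i) ∈ t) :
    MapsTo φ T.closedInterior t := by
  rw [← T.convexHull_eq_closedInterior] at hφ ⊢
  exact hφ.mapsTo_convexHull ht (forall_mem_range.2 h)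

end Module

lemma AffineOn.inner_gradient {E : Type*} [NormedAddCommGroup E] [InnerProductSpace ℝ E]
    [FiniteDimensional ℝ E] {φ : E → ℝ} {s : Set E} (hφ : AffineOn φ s) {x p q : E}
    (hx : x ∈ interior s) (hp : p ∈ s) (hq : q ∈ s) :
    inner ℝ (gradient φ x) (p - q) = φ p - φ q := by
  obtain ⟨L, hL⟩ := hφ
  let L' : E →ᴬ[ℝ] ℝ := ⟨L, L.continuous_of_finiteDimensional⟩
  have hφ' : HasFDerivAt φ L'.contLinear x := L'.hasFDerivAt.congr_of_eventuallyEq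
    (Filter.eventuallyEq_of_mem (mem_interior_iff_mem_nhds.1 hx) hL)
  rw [gradient, hφ'.fderiv, InnerProductSpace.toDual_symm_apply, hL p hp, hL q hq]
  exact L.linearMap_vsub p q

end AffineOn

/-! ### Radial vector fields -/

section IsRadialField

variable {E : Type*} [NormedAddCommGroup E] [InnerProductSpace ℝ E] {F : E → E} {lam C c : ℝ}

/-- `F ξ = h ‖ξ‖ • ξ` is a `C¹` vector field whose profile satisfies `lam ≤ h` and `s |h'(s)| ≤ C`;
this is what the structure of the diffusion coefficient says about the flux at frozen `x`, `η`. -/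
structure IsRadialField (F : E → E) (lam C : ℝ) : Prop where
  contDiff : ContDiff ℝ 1 F
  exists_profile : ∃ h : ℝ → ℝ, (∀ ξ, F ξ = h ‖ξ‖ • ξ) ∧ (∀ s, 0 ≤ s → lam ≤ h s) ∧
    ∀ s, 0 < s → DifferentiableAt ℝ h s ∧ s * |deriv h s| ≤ C

lemma IsRadialField.bound_nonneg (hF : IsRadialField F lam C) : 0 ≤ C := by
  obtain ⟨h, -, -, hderiv⟩ := hF.exists_profile
  exact le_trans (by positivity) (hderiv 1 one_pos).2

lemma hasFDerivAt_radial {h : ℝ → ℝ} {ξ : E} (hξ : ξ ≠ 0) (hh : DifferentiableAt ℝ h ‖ξ‖) :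
    HasFDerivAt (fun ξ => h ‖ξ‖ • ξ) (h ‖ξ‖ • ContinuousLinearMap.id ℝ E
      + ((deriv h ‖ξ‖ / ‖ξ‖) • innerSL ℝ ξ).smulRight ξ) ξ := by
  have hnorm : HasFDerivAt (fun ξ : E => ‖ξ‖) (‖ξ‖⁻¹ • innerSL ℝ ξ) ξ := by
    have hsqrt := (hasStrictFDerivAt_norm_sq ξ).hasFDerivAt.sqrt (by simpa using hξ)
    simp only [Real.sqrt_sq (norm_nonneg _)] at hsqrt
    convert hsqrt using 1
    ext ω
    simp only [smul_apply, innerSL_apply_apply, smul_eq_mul, nsmul_eq_mul]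
    push_cast
    ring
  refine ((hh.hasDerivAt.comp_hasFDerivAt ξ hnorm).smul (hasFDerivAt_id ξ)).congr_fderiv ?_
  rw [smul_smul, ← div_eq_mul_inv]
  rfl

lemma IsRadialField.le_inner_fderiv_of_ne_zero (hF : IsRadialField F lam C) {ξ ω ζ : E}
    (hξ : ξ ≠ 0) (hωζ : 0 ≤ inner ℝ ω ζ) :
    lam * inner ℝ ω ζ - C * (‖ω‖ * ‖ζ‖) ≤ inner ℝ (fderiv ℝ F ξ ω) ζ := by
  obtain ⟨h, hFh, hlow, hderiv⟩ := hF.exists_profile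
  have hξ' : 0 < ‖ξ‖ := norm_pos_iff.2 hξ
  obtain ⟨hdiff, hbound⟩ := hderiv ‖ξ‖ hξ'
  have hfderiv : inner ℝ (fderiv ℝ F ξ ω) ζ
      = h ‖ξ‖ * inner ℝ ω ζ + deriv h ‖ξ‖ / ‖ξ‖ * inner ℝ ξ ω * inner ℝ ξ ζ := by
    rw [funext hFh, (hasFDerivAt_radial hξ hdiff).fderiv]
    simp [inner_add_left, real_inner_smul_left]
  have hradial : |deriv h ‖ξ‖ / ‖ξ‖ * inner ℝ ξ ω * inner ℝ ξ ζ| ≤ C * (‖ω‖ * ‖ζ‖) :=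
    calc |deriv h ‖ξ‖ / ‖ξ‖ * inner ℝ ξ ω * inner ℝ ξ ζ|
        = |deriv h ‖ξ‖| / ‖ξ‖ * |inner ℝ ξ ω| * |inner ℝ ξ ζ| := by
          rw [abs_mul, abs_mul, abs_div, abs_norm]
      _ ≤ |deriv h ‖ξ‖| / ‖ξ‖ * (‖ξ‖ * ‖ω‖) * (‖ξ‖ * ‖ζ‖) := by
          gcongr <;> exact abs_real_inner_le_norm _ _
      _ = ‖ξ‖ * |deriv h ‖ξ‖| * (‖ω‖ * ‖ζ‖) := by field_simp
      _ ≤ C * (‖ω‖ * ‖ζ‖) := by gcongr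
  have hangular := mul_le_mul_of_nonneg_right (hlow ‖ξ‖ hξ'.le) hωζ
  linarith [neg_le_of_abs_le hradial]

lemma IsRadialField.le_inner_fderiv (hF : IsRadialField F lam C) (ξ : E) {ω ζ : E}
    (hωζ : 0 ≤ inner ℝ ω ζ) :
    lam * inner ℝ ω ζ - C * (‖ω‖ * ‖ζ‖) ≤ inner ℝ (fderiv ℝ F ξ ω) ζ := by
  rcases eq_or_ne ω 0 with rfl | hω
  · simp
  have : Nontrivial E := ⟨ω, 0, hω⟩
  have : Filter.NeBot (nhdsWithin (0 : E) {0}ᶜ) := Module.punctured_nhds_neBot ℝ E 0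
  have hcont : Continuous fun ξ => inner ℝ (fderiv ℝ F ξ ω) ζ :=
    ((hF.contDiff.continuous_fderiv one_ne_zero).clm_apply continuous_const).inner continuous_const
  exact (dense_compl_singleton (0 : E)).induction (fun ξ hξ => hF.le_inner_fderiv_of_ne_zero hξ hωζ)
    (isClosed_le continuous_const hcont) ξ

/-- The acuteness of the angles between the `ω i` and `ζ` is what keeps the ellipticity constant
`lam` effective off the diagonal. -/
lemma IsRadialField.le_inner_sub (hF : IsRadialField F lam C) (hlam : 0 ≤ lam) (hc : 0 ≤ c)
    {ι : Type*} {t : Finset ι} {ω : ι → E} {ζ ξ₁ ξ₂ : E} (hξ : ξ₁ - ξ₂ = ∑ i ∈ t, ω i)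
    (hω : ∀ i ∈ t, c * (‖ω i‖ * ‖ζ‖) ≤ inner ℝ (ω i) ζ) :
    (lam * c - C) * ((∑ i ∈ t, ‖ω i‖) * ‖ζ‖) ≤ inner ℝ (F ξ₁ - F ξ₂) ζ := by
  have hline (s : ℝ) : HasDerivAt (fun s : ℝ => inner ℝ (F (ξ₂ + s • (ξ₁ - ξ₂))) ζ)
      (inner ℝ (fderiv ℝ F (ξ₂ + s • (ξ₁ - ξ₂)) (ξ₁ - ξ₂)) ζ) s := by
    have hseg : HasDerivAt (fun s : ℝ => ξ₂ + s • (ξ₁ - ξ₂)) (ξ₁ - ξ₂) s := by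
      simpa using ((hasDerivAt_id s).smul_const (ξ₁ - ξ₂)).const_add ξ₂
    have hcomp := (hF.contDiff.differentiable one_ne_zero _).hasFDerivAt.comp_hasDerivAt s hseg
    simpa using hcomp.inner ℝ (hasDerivAt_const s ζ)
  obtain ⟨s, -, hs⟩ := exists_hasDerivAt_eq_slope _ _ (zero_lt_one' ℝ)
    (fun s _ => (hline s).continuousAt.continuousWithinAt) (fun s _ => hline s)
  have hmean : inner ℝ (F ξ₁ - F ξ₂) ζ
      = ∑ i ∈ t, inner ℝ (fderiv ℝ F (ξ₂ + s • (ξ₁ - ξ₂)) (ω i)) ζ := by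
    rw [← sum_inner, ← map_sum, ← hξ, hs]
    simp [inner_sub_left]
  rw [hmean, Finset.sum_mul, Finset.mul_sum]
  refine Finset.sum_le_sum fun i hi => ?_
  have hinner := hω i hi
  have hderiv := hF.le_inner_fderiv (ξ₂ + s • (ξ₁ - ξ₂)) (le_trans (by positivity) hinner)
  linarith [mul_le_mul_of_nonneg_left hinner hlam]

end IsRadialField

/-! ### Geometry of a triangle -/

section Triangle

variable (T : Affine.Triangle ℝ Plane)

/-- The vertices of `T` as an affine basis of the plane. -/
noncomputable def vertexBasis : AffineBasis (Fin 3) ℝ Plane :=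
  ⟨T.points, T.independent, T.independent.affineSpan_eq_top_iff_card_eq_finrank_add_one.2 (by simp)⟩

lemma vertexBasis_apply (i : Fin 3) : vertexBasis T i = T.points i := rfl

lemma convex_closedInterior : Convex ℝ T.closedInterior :=
  T.convexHull_eq_closedInterior ▸ convex_convexHull ℝ _

/-- The gradient of the nodal basis function of the vertex `i`, that is, of the `i`-th barycentric
coordinate. -/
noncomputable def nodalGradient (i : Fin 3) : Plane := gradient ((vertexBasis T).coord i) 0

lemma inner_nodalGradient (i : Fin 3) (p q : Plane) :
    inner ℝ (nodalGradient T i) (p - q) = (vertexBasis T).coord i p - (vertexBasis T).coord i q :=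
  AffineOn.inner_gradient (s := univ) ⟨(vertexBasis T).coord i, fun _ _ => rfl⟩
    (by simp) (mem_univ p) (mem_univ q)

lemma inner_nodalGradient_points (i j k : Fin 3) :
    inner ℝ (nodalGradient T i) (T.points j - T.points k)
      = (if i = j then 1 else 0) - if i = k then 1 else 0 := by
  rw [inner_nodalGradient, ← vertexBasis_apply, ← vertexBasis_apply, AffineBasis.coord_apply,
    AffineBasis.coord_apply]

lemma sum_inner_smul_nodalGradient (ξ : Plane) (k : Fin 3) :
    ∑ i, inner ℝ ξ (T.points i - T.points k) • nodalGradient T i = ξ := by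
  let b := vertexBasis T
  refine ext_inner_right ℝ fun ω => ?_
  have hedges : ∑ i, b.coord i (ω + T.points k) • (T.points i - T.points k) = ω := by
    have hcomb : ∑ i, b.coord i (ω + T.points k) • T.points i = ω + T.points k :=
      b.linear_combination_coord_eq_self (ω + T.points k)
    simp only [smul_sub, Finset.sum_sub_distrib, ← Finset.sum_smul, b.sum_coord_apply_eq_one,
      one_smul, hcomb, add_sub_cancel_right]
  calc inner ℝ (∑ i, inner ℝ ξ (T.points i - T.points k) • nodalGradient T i) ω
      = ∑ i, inner ℝ ξ (T.points i - T.points k) *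
          (b.coord i (ω + T.points k) - b.coord i (T.points k)) := by
        simp only [b, ← inner_nodalGradient, add_sub_cancel_right, sum_inner,
          real_inner_smul_left]
    _ = ∑ i, inner ℝ ξ (b.coord i (ω + T.points k) • (T.points i - T.points k)) := by
        refine Finset.sum_congr rfl fun i _ => ?_
        rw [real_inner_smul_right]
        rcases eq_or_ne i k with rfl | hik
        · simp
        · rw [← vertexBasis_apply T k, b.coord_apply_ne hik]
          ring
    _ = inner ℝ ξ ω := by rw [← inner_sum, hedges]

variable {T}

lemma gradient_eq_sum_nodalGradient {φ : Plane → ℝ} (hφ : AffineOn φ T.closedInterior)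
    {x : Plane} (hx : x ∈ interior T.closedInterior) (k : Fin 3) :
    gradient φ x = ∑ i, (φ (T.points i) - φ (T.points k)) • nodalGradient T i := by
  rw [← sum_inner_smul_nodalGradient T (gradient φ x) k]
  simp only [hφ.inner_gradient hx (T.point_mem_closedInterior _) (T.point_mem_closedInterior _)]

lemma angle_eq {i j k : Fin 3} (hik : i ≠ k) (hjk : j ≠ k) (hij : i ≠ j) :
    angle T k = InnerProductGeometry.angle (T.points i - T.points k) (T.points j - T.points k) := by
  have : i = k + 1 ∧ j = k + 2 ∨ i = k + 2 ∧ j = k + 1 := by lia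
  rcases this with ⟨rfl, rfl⟩ | ⟨rfl, rfl⟩
  · rfl
  · rw [InnerProductGeometry.angle_comm]
    rfl

lemma gram_smul_nodalGradient {i j k : Fin 3} (hik : i ≠ k) (hjk : j ≠ k) (hij : i ≠ j) :
    (Real.sin (angle T k) * (‖T.points i - T.points k‖ * ‖T.points j - T.points k‖)) ^ 2
        • nodalGradient T i
      = ‖T.points j - T.points k‖ ^ 2 • (T.points i - T.points k)
        - inner ℝ (T.points i - T.points k) (T.points j - T.points k)
          • (T.points j - T.points k) := by
  have hrep (ξ : Plane) : inner ℝ ξ (T.points i - T.points k) • nodalGradient T i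
      + inner ℝ ξ (T.points j - T.points k) • nodalGradient T j = ξ := by
    have huniv : (Finset.univ : Finset (Fin 3)) = {i, j, k} := by
      revert i j k; decide
    have hsum := sum_inner_smul_nodalGradient T ξ k
    rwa [huniv, Finset.sum_insert (by simp [hij, hik]), Finset.sum_insert (by simp [hjk]),
      Finset.sum_singleton, sub_self, inner_zero_right, zero_smul, add_zero] at hsum
  rw [angle_eq hik hjk hij, InnerProductGeometry.sin_angle_mul_norm_mul_norm]
  generalize T.points i - T.points k = a at *
  generalize T.points j - T.points k = b at *
  have hgram : 0 ≤ inner ℝ a a * inner ℝ b b - inner ℝ a b * inner ℝ a b := by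
    linarith [real_inner_mul_inner_self_le a b]
  rw [Real.sq_sqrt hgram, ← real_inner_self_eq_norm_sq]
  conv_rhs => rw [← hrep (inner ℝ b b • a - inner ℝ a b • b)]
  simp only [inner_sub_left, real_inner_smul_left, real_inner_comm a b]
  module

/-- The length of the gradient of a nodal basis function is the reciprocal of a height of `T`. -/
lemma norm_nodalGradient_mul_dist_mul_sin {i k : Fin 3} (hik : i ≠ k) :
    ‖nodalGradient T i‖ * dist (T.points i) (T.points k) * Real.sin (angle T k) = 1 := by
  obtain ⟨j, hjk, hij⟩ : ∃ j, j ≠ k ∧ i ≠ j := by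
    revert i k; decide
  have hgram := congrArg (inner ℝ (nodalGradient T i))
    (gram_smul_nodalGradient (T := T) hik hjk hij)
  rw [inner_sub_right, real_inner_smul_right, real_inner_smul_right, real_inner_smul_right,
    real_inner_self_eq_norm_sq, inner_nodalGradient_points, inner_nodalGradient_points, if_pos rfl,
    if_neg hik, if_neg hij] at hgram
  have hb : 0 < ‖T.points j - T.points k‖ :=
    norm_pos_iff.2 (sub_ne_zero.2 (T.independent.injective.ne hjk))
  have hsq : (‖nodalGradient T i‖ * dist (T.points i) (T.points k) * Real.sin (angle T k)) ^ 2
      = 1 := by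
    rw [dist_eq_norm]
    refine mul_right_cancel₀ (pow_pos hb 2).ne' ?_
    linear_combination hgram
  have hsin : 0 ≤ Real.sin (angle T k) := InnerProductGeometry.sin_angle_nonneg _ _
  have hnonneg : 0 ≤ ‖nodalGradient T i‖ * dist (T.points i) (T.points k)
      * Real.sin (angle T k) := by positivity
  exact (pow_eq_one_iff_of_nonneg hnonneg two_ne_zero).1 hsq

lemma inner_nodalGradient_nodalGradient {i j k : Fin 3} (hik : i ≠ k) (hjk : j ≠ k) (hij : i ≠ j) :
    inner ℝ (nodalGradient T i) (nodalGradient T j)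
      = -(Real.cos (angle T k) * (‖nodalGradient T i‖ * ‖nodalGradient T j‖)) := by
  have hi := norm_nodalGradient_mul_dist_mul_sin (T := T) hik
  have hj := norm_nodalGradient_mul_dist_mul_sin (T := T) hjk
  have hgram := congrArg (inner ℝ (nodalGradient T j))
    (gram_smul_nodalGradient (T := T) hik hjk hij)
  rw [inner_sub_right, real_inner_smul_right, real_inner_smul_right, real_inner_smul_right,
    inner_nodalGradient_points, inner_nodalGradient_points, if_pos rfl, if_neg hjk, if_neg hij.symm,
    ← InnerProductGeometry.cos_angle_mul_norm_mul_norm (T.points i - T.points k),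
    ← angle_eq hik hjk hij, real_inner_comm] at hgram
  rw [dist_eq_norm] at hi hj
  have hdet : Real.sin (angle T k) * (‖T.points i - T.points k‖ * ‖T.points j - T.points k‖)
      ≠ 0 := fun h => by
    have hprod : ‖nodalGradient T i‖ * ‖nodalGradient T j‖ * Real.sin (angle T k)
        * (Real.sin (angle T k) * (‖T.points i - T.points k‖ * ‖T.points j - T.points k‖)) = 1 := by
      linear_combination ‖nodalGradient T j‖ * ‖T.points j - T.points k‖ * Real.sin (angle T k) * hi
        + hj
    simp [h] at hprod
  refine mul_left_cancel₀ (pow_ne_zero 2 hdet) ?_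
  linear_combination hgram + Real.cos (angle T k)
    * (‖T.points i - T.points k‖ * ‖T.points j - T.points k‖)
    * (‖nodalGradient T j‖ * ‖T.points j - T.points k‖ * Real.sin (angle T k) * hi + hj)

lemma norm_nodalGradient_pos (i : Fin 3) : 0 < ‖nodalGradient T i‖ := by
  have hne : i ≠ i + 1 := by simp
  refine norm_pos_iff.2 fun h => ?_
  simpa [h] using norm_nodalGradient_mul_dist_mul_sin (T := T) hne

lemma sin_angle_pos (k : Fin 3) : 0 < Real.sin (angle T k) := by
  have hne : k + 1 ≠ k := by simp
  have hnonneg : 0 ≤ Real.sin (angle T k) := InnerProductGeometry.sin_angle_nonneg _ _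
  refine hnonneg.lt_of_ne' fun h => ?_
  simpa [h] using norm_nodalGradient_mul_dist_mul_sin (T := T) hne

lemma cosMin_le (i : Fin 3) : cosMin T ≤ Real.cos (angle T i) :=
  Finset.inf'_le _ (Finset.mem_univ i)

lemma le_sinMax (i : Fin 3) : Real.sin (angle T i) ≤ sinMax T :=
  Finset.le_sup' (fun i => Real.sin (angle T i)) (Finset.mem_univ i)

lemma sinRatio_le (i j : Fin 3) :
    sinRatio T ≤ Real.sin (angle T i) / Real.sin (angle T j) :=
  Finset.inf'_le (fun p : Fin 3 × Fin 3 => Real.sin (angle T p.1) / Real.sin (angle T p.2))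
    (Finset.mem_univ (i, j))

lemma le_vertexVariation (φ : Plane → ℝ) (i j : Fin 3) :
    |φ (T.points i) - φ (T.points j)| ≤ vertexVariation T φ :=
  Finset.le_sup' (fun p : Fin 3 × Fin 3 => |φ (T.points p.1) - φ (T.points p.2)|)
    (Finset.mem_univ (i, j))

lemma sinMax_pos : 0 < sinMax T := (sin_angle_pos 0).trans_le (le_sinMax 0)

lemma vertexVariation_nonneg (φ : Plane → ℝ) : 0 ≤ vertexVariation T φ :=
  (abs_nonneg _).trans (le_vertexVariation φ 0 0)

lemma sinRatio_pos : 0 < sinRatio T :=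
  (Finset.lt_inf'_iff _).2 fun _ _ => div_pos (sin_angle_pos _) (sin_angle_pos _)

lemma sinRatio_mul_norm_nodalGradient_le (i j : Fin 3) :
    sinRatio T * ‖nodalGradient T i‖ ≤ ‖nodalGradient T j‖ := by
  have hratio := sinRatio_le (T := T) j i
  rw [le_div_iff₀ (sin_angle_pos i)] at hratio
  rcases eq_or_ne i j with rfl | hij
  · exact mul_le_of_le_one_left (norm_nonneg _) (le_of_mul_le_mul_right
      (hratio.trans_eq (one_mul _).symm) (sin_angle_pos i))
  have hi := norm_nodalGradient_mul_dist_mul_sin (T := T) hij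
  have hj := norm_nodalGradient_mul_dist_mul_sin (T := T) hij.symm
  rw [dist_comm] at hj
  calc sinRatio T * ‖nodalGradient T i‖
      = sinRatio T * Real.sin (angle T i)
          * (‖nodalGradient T j‖ * dist (T.points i) (T.points j) * ‖nodalGradient T i‖) := by
        linear_combination -(sinRatio T * ‖nodalGradient T i‖) * hj
    _ ≤ Real.sin (angle T j)
          * (‖nodalGradient T j‖ * dist (T.points i) (T.points j) * ‖nodalGradient T i‖) := by
        gcongr
    _ = ‖nodalGradient T j‖ := by linear_combination ‖nodalGradient T j‖ * hi

lemma norm_gradient_le {φ : Plane → ℝ} (hφ : AffineOn φ T.closedInterior) {x : Plane}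
    (hx : x ∈ interior T.closedInterior) (i : Fin 3) :
    ‖gradient φ x‖ ≤ vertexVariation T φ * (1 + (sinRatio T)⁻¹) * ‖nodalGradient T i‖ := by
  have huniv : (Finset.univ : Finset (Fin 3)) = {i, i + 1, i + 2} := by
    revert i; decide
  have hterm (j l : Fin 3) : ‖(φ (T.points j) - φ (T.points l)) • nodalGradient T j‖
      ≤ vertexVariation T φ * ‖nodalGradient T j‖ := by
    rw [norm_smul]
    gcongr
    exact le_vertexVariation φ j l
  have hratio : ‖nodalGradient T (i + 1)‖ ≤ (sinRatio T)⁻¹ * ‖nodalGradient T i‖ := by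
    rw [le_inv_mul_iff₀ sinRatio_pos]
    exact sinRatio_mul_norm_nodalGradient_le (i + 1) i
  have hsum := gradient_eq_sum_nodalGradient hφ hx (i + 2)
  rw [huniv, Finset.sum_insert (by simp), Finset.sum_insert (by simp), Finset.sum_singleton,
    sub_self, zero_smul, add_zero] at hsum
  calc ‖gradient φ x‖
      ≤ vertexVariation T φ * ‖nodalGradient T i‖
          + vertexVariation T φ * ‖nodalGradient T (i + 1)‖ :=
        hsum ▸ norm_add_le_of_le (hterm _ _) (hterm _ _)
    _ ≤ vertexVariation T φ * ‖nodalGradient T i‖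
          + vertexVariation T φ * ((sinRatio T)⁻¹ * ‖nodalGradient T i‖) := by
        have := vertexVariation_nonneg (T := T) φ
        gcongr
    _ = vertexVariation T φ * (1 + (sinRatio T)⁻¹) * ‖nodalGradient T i‖ := by ring

lemma cosMin_mul_le_neg_inner_nodalGradient {i k : Fin 3} (hik : i ≠ k) :
    cosMin T * (‖nodalGradient T i‖ * ‖nodalGradient T k‖)
      ≤ -inner ℝ (nodalGradient T i) (nodalGradient T k) := by
  obtain ⟨j, hij, hkj⟩ : ∃ j, i ≠ j ∧ k ≠ j := by
    revert i k; decide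
  rw [inner_nodalGradient_nodalGradient hij hkj hik, neg_neg]
  gcongr
  exact cosMin_le j

lemma volume_real_parallelepiped_pair (a b : Plane) :
    volume.real (parallelepiped ![a, b])
      = Real.sin (InnerProductGeometry.angle a b) * (‖a‖ * ‖b‖) := by
  rw [InnerProductGeometry.sin_angle_mul_norm_mul_norm,
    ← (EuclideanSpace.basisFun (Fin 2) ℝ).addHaar_eq_volume, Measure.real,
    Measure.addHaar_parallelepiped, ENNReal.toReal_ofReal (abs_nonneg _), ← Real.sqrt_sq_eq_abs,
    Module.Basis.det_apply, Matrix.det_fin_two]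
  simp only [Module.Basis.toMatrix_apply, PiLp.inner_apply, Fin.sum_univ_two, RCLike.inner_apply,
    OrthonormalBasis.coe_toBasis_repr_apply, EuclideanSpace.basisFun_repr, Matrix.cons_val,
    conj_trivial]
  ring_nf

/-- The parallelogram is covered by a triangle in `s` and its reflection in the midpoint of the
third side. -/
lemma volume_real_parallelepiped_pair_le {s : Set Plane} (hs : Convex ℝ s) (hs' : IsCompact s)
    {p q r : Plane} (hp : p ∈ s) (hq : q ∈ s) (hr : r ∈ s) :
    volume.real (parallelepiped ![q - p, r - p]) ≤ 2 * volume.real s := by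
  have hmem {c d : ℝ} (hc : 0 ≤ c) (hd : 0 ≤ d) (hcd : c + d ≤ 1) :
      p + (c • (q - p) + d • (r - p)) ∈ s := by
    convert hs.sum_mem (t := Finset.univ) (w := ![1 - c - d, c, d]) (z := ![p, q, r])
      ?_ ?_ ?_ using 1
    · simp only [Fin.sum_univ_three, Matrix.cons_val]
      module
    · simp [Fin.forall_fin_succ, hc, hd, le_sub_iff_add_le, add_comm, hcd]
    · simp only [Fin.sum_univ_three, Matrix.cons_val]
      ring
    · simp [Fin.forall_fin_succ, hp, hq, hr]
  have hsub : parallelepiped ![q - p, r - p]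
      ⊆ (fun x => p + x) ⁻¹' s ∪ (fun x => q + r - p - x) ⁻¹' s := by
    intro x hx
    obtain ⟨c, hc, rfl⟩ := (mem_parallelepiped_iff _ _).1 hx
    simp only [Fin.sum_univ_two, Matrix.cons_val_zero, Matrix.cons_val_one]
    rcases le_total (c 0 + c 1) 1 with h | h
    · exact Or.inl (hmem (hc.1 0) (hc.1 1) h)
    · refine Or.inr ?_
      rw [mem_preimage]
      convert hmem (sub_nonneg.2 (hc.2 0)) (sub_nonneg.2 (hc.2 1))
        (by simp only [Pi.one_apply]; linarith) using 1
      simp only [Pi.one_apply]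
      module
  have hvol : volume (parallelepiped ![q - p, r - p]) ≤ volume s + volume s := by
    refine (measure_mono hsub).trans ((measure_union_le _ _).trans_eq ?_)
    rw [measure_preimage_add, (Measure.measurePreserving_sub_left volume _).measure_preimage
      hs'.measurableSet.nullMeasurableSet]
  have hfin := hs'.measure_ne_top (μ := volume)
  rw [two_mul, Measure.real, Measure.real, ← ENNReal.toReal_add hfin hfin]
  exact ENNReal.toReal_mono (ENNReal.add_ne_top.2 ⟨hfin, hfin⟩) hvol

lemma one_le_two_mul_area_mul_sinMax_mul {i k : Fin 3} (hik : i ≠ k) :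
    1 ≤ 2 * area T * sinMax T * (‖nodalGradient T i‖ * ‖nodalGradient T k‖) := by
  obtain ⟨j, hij, hkj⟩ : ∃ j, i ≠ j ∧ k ≠ j := by
    revert i k; decide
  have hi := norm_nodalGradient_mul_dist_mul_sin (T := T) hij
  have hk := norm_nodalGradient_mul_dist_mul_sin (T := T) hkj
  have harea : Real.sin (angle T j)
      * (dist (T.points i) (T.points j) * dist (T.points k) (T.points j))
      ≤ 2 * area T := by
    rw [angle_eq hij hkj hik, dist_eq_norm, dist_eq_norm, ← volume_real_parallelepiped_pair]
    exact volume_real_parallelepiped_pair_le (convex_closedInterior T) T.isCompact_closedInterior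
      (T.point_mem_closedInterior j) (T.point_mem_closedInterior i) (T.point_mem_closedInterior k)
  calc 1 = Real.sin (angle T j)
          * (dist (T.points i) (T.points j) * dist (T.points k) (T.points j))
          * Real.sin (angle T j) * (‖nodalGradient T i‖ * ‖nodalGradient T k‖) := by
        linear_combination -(‖nodalGradient T k‖ * dist (T.points k) (T.points j)
          * Real.sin (angle T j)) * hi - hk
    _ ≤ 2 * area T * sinMax T * (‖nodalGradient T i‖ * ‖nodalGradient T k‖) := by
        have := (sin_angle_pos (T := T) j).le
        have : 0 ≤ area T := measureReal_nonneg
        gcongr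
        exact le_sinMax j

end Triangle

/-! ### The difference of the integrands on a triangle -/

section AdmissibleAt

variable {A : Plane → ℝ → Plane → ℝ} {b : Plane → ℝ → ℝ} {lam C K B : ℝ} {x : Plane}

/-- The pointwise consequences of the assumptions on the coefficients that the comparison argument
relies on: a radial flux at frozen `η`, Lipschitz bounds in `η`, and monotonicity of `b`. -/
structure AdmissibleAt (A : Plane → ℝ → Plane → ℝ) (b : Plane → ℝ → ℝ) (lam C K B : ℝ)
    (x : Plane) : Prop where
  isRadialField : ∀ η, IsRadialField (flux A x η) lam C
  abs_diffusion_sub_le : ∀ η₁ η₂ ξ, |A x η₁ ξ - A x η₂ ξ| ≤ K * |η₁ - η₂|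
  monotone : Monotone (b x)
  abs_reaction_sub_le : ∀ η₁ η₂, |b x η₁ - b x η₂| ≤ B * |η₁ - η₂|

lemma AdmissibleAt.diffusion_bound_nonneg (hA : AdmissibleAt A b lam C K B x) : 0 ≤ K := by
  simpa using (abs_nonneg _).trans (hA.abs_diffusion_sub_le 1 0 0)

lemma AdmissibleAt.reaction_bound_nonneg (hA : AdmissibleAt A b lam C K B x) : 0 ≤ B := by
  simpa using (abs_nonneg _).trans (hA.abs_reaction_sub_le 1 0)

lemma AdmissibleAt.abs_inner_flux_sub_le (hA : AdmissibleAt A b lam C K B x) (η₁ η₂ : ℝ)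
    (ξ ζ : Plane) :
    |inner ℝ (flux A x η₁ ξ - flux A x η₂ ξ) ζ| ≤ K * |η₁ - η₂| * (‖ξ‖ * ‖ζ‖) := by
  have hA' := hA.abs_diffusion_sub_le η₁ η₂ ξ
  rw [flux, flux, ← sub_smul, real_inner_smul_left, abs_mul]
  exact mul_le_mul hA' (abs_real_inner_le_norm ξ ζ) (abs_nonneg _) ((abs_nonneg _).trans hA')

/-- The argument `η` can be frozen at `η₁` or at `η₂`, whence the minimum: a gradient bound for
either one of the two functions that are compared controls the error. -/
lemma AdmissibleAt.le_inner_flux_sub (hA : AdmissibleAt A b lam C K B x) {η₁ η₂ m : ℝ}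
    {ξ₁ ξ₂ ζ : Plane} (hm : ∀ η, m ≤ inner ℝ (flux A x η ξ₁ - flux A x η ξ₂) ζ) :
    m - K * |η₁ - η₂| * (min ‖ξ₁‖ ‖ξ₂‖ * ‖ζ‖)
      ≤ inner ℝ (flux A x η₁ ξ₁ - flux A x η₂ ξ₂) ζ := by
  have hfreeze (ξ : Plane) := neg_le_of_abs_le (hA.abs_inner_flux_sub_le η₁ η₂ ξ ζ)
  have h₁ := hm η₁
  have h₂ := hm η₂
  have hξ₁ := hfreeze ξ₁
  have hξ₂ := hfreeze ξ₂
  simp only [inner_sub_left] at h₁ h₂ hξ₁ hξ₂ ⊢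
  rcases min_choice ‖ξ₁‖ ‖ξ₂‖ with h | h <;> rw [h] <;> linarith

lemma AdmissibleAt.le_reaction_sub_mul (hA : AdmissibleAt A b lam C K B x) {η₁ η₂ t : ℝ}
    (ht : t ∈ Icc 0 1) : -(B * |η₁ - η₂|) ≤ (b x η₁ - b x η₂) * t := by
  have hbound : |(b x η₁ - b x η₂) * t| ≤ B * |η₁ - η₂| := by
    rw [abs_mul, abs_of_nonneg ht.1]
    exact (mul_le_of_le_one_right (abs_nonneg _) ht.2).trans (hA.abs_reaction_sub_le η₁ η₂)
  exact neg_le_of_abs_le hbound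

end AdmissibleAt

/-- A weaker form of the mesh condition on a single triangle, for the comparison of `u₁` and `u₂`:
the smaller of the two vertex variations counts, and the factors `7 / 6` are replaced by `1`. -/
def IsMeshFine (lam C K B : ℝ) (u₁ u₂ : Plane → ℝ) (T : Affine.Triangle ℝ Plane) : Prop :=
  K * (min (vertexVariation T u₁) (vertexVariation T u₂) * (1 + (sinRatio T)⁻¹))
    + B * (2 * area T * sinMax T) < lam * cosMin T - C

lemma IsMeshFine.symm {lam C K B : ℝ} {u₁ u₂ : Plane → ℝ} {T : Affine.Triangle ℝ Plane}
    (hT : IsMeshFine lam C K B u₁ u₂ T) : IsMeshFine lam C K B u₂ u₁ T := by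
  rwa [IsMeshFine, min_comm]

/-- The vertex values of `v` are those of the indicator function of `{w > 0}`. -/
def IsVertexIndicator (T : Affine.Triangle ℝ Plane) (v w : Plane → ℝ) : Prop :=
  ∀ i, v (T.points i) = if 0 < w (T.points i) then 1 else 0

/-- The variation of `w` along the two edges of `T` that meet in the vertex `k`. -/
noncomputable def edgeVariation (T : Affine.Triangle ℝ Plane) (w : Plane → ℝ) (k : Fin 3) : ℝ :=
  ∑ i ∈ {k}ᶜ, |w (T.points i) - w (T.points k)|

section Triangle

variable {A : Plane → ℝ → Plane → ℝ} {b : Plane → ℝ → ℝ} {lam C K B : ℝ}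
  {T : Affine.Triangle ℝ Plane} {u₁ u₂ v w : Plane → ℝ} {x : Plane} {k : Fin 3}

lemma weakIntegrand_sub_weakIntegrand (u₁ u₂ v : Plane → ℝ) (x : Plane) :
    weakIntegrand A b u₁ v x - weakIntegrand A b u₂ v x =
      inner ℝ (flux A x (u₁ x) (gradient u₁ x) - flux A x (u₂ x) (gradient u₂ x)) (gradient v x)
        + (b x (u₁ x) - b x (u₂ x)) * v x := by
  simp only [weakIntegrand, inner_sub_left]
  ring

lemma gradient_eq_smul_nodalGradient {φ : Plane → ℝ} (hφ : AffineOn φ T.closedInterior)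
    (hx : x ∈ interior T.closedInterior) {m : ℝ} (hm : ∀ i ≠ k, φ (T.points i) = m) :
    gradient φ x = (φ (T.points k) - m) • nodalGradient T k := by
  rw [gradient_eq_sum_nodalGradient hφ hx (k + 1), Finset.sum_eq_single k, hm (k + 1) (by simp)]
  · intro i _ hi
    rw [hm i hi, hm (k + 1) (by simp), sub_self, zero_smul]
  · simp

lemma forall_eq_or_exists_lone {c : Fin 3 → ℝ} (hc : ∀ i, c i = 0 ∨ c i = 1) :
    (∃ m, ∀ i, c i = m) ∨ ∃ k, ∀ i ≠ k, c i = 1 - c k := by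
  simp only [Fin.exists_fin_succ, Fin.forall_fin_succ]
  rcases hc 0 with h₀ | h₀ <;> rcases hc 1 with h₁ | h₁ <;> rcases hc 2 with h₂ | h₂ <;>
    simp [h₀, h₁, h₂]

lemma IsVertexIndicator.eq_zero_or_eq_one (hv : IsVertexIndicator T v w) (i : Fin 3) :
    v (T.points i) = 0 ∨ v (T.points i) = 1 := by
  rw [hv i]
  split_ifs <;> simp

lemma IsVertexIndicator.mem_Icc (hv : IsVertexIndicator T v w) (hv' : AffineOn v T.closedInterior)
    (hx : x ∈ T.closedInterior) : v x ∈ Icc 0 1 :=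
  hv'.mapsTo_closedInterior (convex_Icc 0 1)
    (fun i => by rcases hv.eq_zero_or_eq_one i with h | h <;> simp [h]) hx

/-- Across an edge on which `v` jumps, the values of `w` have opposite signs. -/
lemma IsVertexIndicator.gap_of_lone (hv : IsVertexIndicator T v w)
    (hk : ∀ i ≠ k, v (T.points i) = 1 - v (T.points k)) {i : Fin 3} (hi : i ≠ k) :
    0 < (w (T.points i) - w (T.points k)) * (1 - 2 * v (T.points k)) ∧
      |w (T.points i)| ≤ |w (T.points i) - w (T.points k)| ∧
      |w (T.points k)| ≤ |w (T.points i) - w (T.points k)| := by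
  have hik := hk i hi
  rw [hv i, hv k] at hik
  rw [hv k]
  by_cases hwk : 0 < w (T.points k) <;> by_cases hwi : 0 < w (T.points i) <;>
    simp only [hwk, hwi, if_true, if_false] at hik ⊢ <;> norm_num at hik
  · rw [abs_of_nonpos (not_lt.1 hwi), abs_of_pos hwk, abs_of_neg (by linarith)]
    refine ⟨?_, ?_, ?_⟩ <;> linarith
  · rw [abs_of_pos hwi, abs_of_nonpos (not_lt.1 hwk), abs_of_pos (by linarith)]
    refine ⟨?_, ?_, ?_⟩ <;> linarith

lemma IsVertexIndicator.edgeVariation_pos (hv : IsVertexIndicator T v w)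
    (hk : ∀ i ≠ k, v (T.points i) = 1 - v (T.points k)) : 0 < edgeVariation T w k :=
  Finset.sum_pos (fun i hi => abs_pos.2 (left_ne_zero_of_mul
    (hv.gap_of_lone hk (by simpa using hi)).1.ne')) ⟨k + 1, by simp⟩

lemma IsVertexIndicator.abs_le_edgeVariation (hv : IsVertexIndicator T v w)
    (hk : ∀ i ≠ k, v (T.points i) = 1 - v (T.points k)) (hw : AffineOn w T.closedInterior)
    (hx : x ∈ T.closedInterior) : |w x| ≤ edgeVariation T w k := by
  have hterm {i : Fin 3} (hi : i ≠ k) :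
      |w (T.points i) - w (T.points k)| ≤ edgeVariation T w k :=
    Finset.single_le_sum (f := fun i => |w (T.points i) - w (T.points k)|)
      (fun _ _ => abs_nonneg _) (by simpa using hi)
  have hvertex (i : Fin 3) : |w (T.points i)| ≤ edgeVariation T w k := by
    rcases eq_or_ne i k with rfl | hi
    · exact (hv.gap_of_lone hk (i := i + 1) (by simp)).2.2.trans (hterm (by simp))
    · exact (hv.gap_of_lone hk hi).2.1.trans (hterm hi)
  exact abs_le.2 (hw.mapsTo_closedInterior (convex_Icc _ _) (fun i => abs_le.1 (hvertex i)) hx)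

lemma IsVertexIndicator.gradient_eq (hv : IsVertexIndicator T v w)
    (hv' : AffineOn v T.closedInterior) (hk : ∀ i ≠ k, v (T.points i) = 1 - v (T.points k))
    (hx : x ∈ interior T.closedInterior) :
    ∃ σ : ℝ, |σ| = 1 ∧ gradient v x = σ • nodalGradient T k ∧
      ∀ i ≠ k, -(σ * (w (T.points i) - w (T.points k))) = |w (T.points i) - w (T.points k)| := by
  refine ⟨v (T.points k) - (1 - v (T.points k)), ?_, gradient_eq_smul_nodalGradient hv' hx hk,
    fun i hi => ?_⟩
  · rcases hv.eq_zero_or_eq_one k with h | h <;> simp [h]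
  · have hpos := (hv.gap_of_lone hk hi).1
    rcases hv.eq_zero_or_eq_one k with h | h <;> rw [h] at hpos ⊢
    · rw [abs_of_pos (by linarith)]
      ring
    · rw [abs_of_neg (by linarith)]
      ring

lemma IsVertexIndicator.norm_gradient_eq (hv : IsVertexIndicator T v w)
    (hv' : AffineOn v T.closedInterior) (hk : ∀ i ≠ k, v (T.points i) = 1 - v (T.points k))
    (hx : x ∈ interior T.closedInterior) : ‖gradient v x‖ = ‖nodalGradient T k‖ := by
  obtain ⟨σ, hσ, hgrad, -⟩ := hv.gradient_eq hv' hk hx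
  rw [hgrad, norm_smul, Real.norm_eq_abs, hσ, one_mul]

/-- The acuteness of `T` enters here: the jumps of `u₁ - u₂` and of `v` along the edges at the lone
vertex `k` have the same sign, and the gradients of two nodal basis functions form an obtuse
angle. -/
lemma le_inner_flux_sub_of_lone (hA : AdmissibleAt A b lam C K B x) (hlam : 0 ≤ lam)
    (hT : 0 ≤ cosMin T) (hx : x ∈ interior T.closedInterior) (hu₁ : AffineOn u₁ T.closedInterior)
    (hu₂ : AffineOn u₂ T.closedInterior) (hv : IsVertexIndicator T v (u₁ - u₂))
    (hv' : AffineOn v T.closedInterior) (hk : ∀ i ≠ k, v (T.points i) = 1 - v (T.points k))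
    (η : ℝ) :
    (lam * cosMin T - C) * ((∑ i ∈ {k}ᶜ,
        |(u₁ - u₂) (T.points i) - (u₁ - u₂) (T.points k)| * ‖nodalGradient T i‖)
        * ‖nodalGradient T k‖)
      ≤ inner ℝ (flux A x η (gradient u₁ x) - flux A x η (gradient u₂ x)) (gradient v x) := by
  obtain ⟨σ, -, hgrad, hsign⟩ := hv.gradient_eq hv' hk hx
  set δ : Fin 3 → ℝ := fun i => (u₁ - u₂) (T.points i) - (u₁ - u₂) (T.points k) with hδ
  have hdiff : gradient u₁ x - gradient u₂ x = ∑ i ∈ {k}ᶜ, δ i • nodalGradient T i := by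
    have hk0 : δ k • nodalGradient T k = 0 := by simp [hδ]
    rw [← zero_add (∑ i ∈ {k}ᶜ, _), ← hk0,
      ← Fintype.sum_eq_add_sum_compl k fun i => δ i • nodalGradient T i,
      gradient_eq_sum_nodalGradient hu₁ hx k, gradient_eq_sum_nodalGradient hu₂ hx k,
      ← Finset.sum_sub_distrib]
    refine Finset.sum_congr rfl fun i _ => ?_
    rw [← sub_smul]
    congr 1
    simp only [hδ, Pi.sub_apply]
    ring
  have hnorm := hv.norm_gradient_eq hv' hk hx
  have hacute (i : Fin 3) (hi : i ∈ ({k}ᶜ : Finset (Fin 3))) :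
      cosMin T * (‖δ i • nodalGradient T i‖ * ‖gradient v x‖)
        ≤ inner ℝ (δ i • nodalGradient T i) (gradient v x) := by
    have hik : i ≠ k := by simpa using hi
    rw [hnorm, norm_smul, Real.norm_eq_abs, hgrad, real_inner_smul_left, real_inner_smul_right]
    calc cosMin T * (|δ i| * ‖nodalGradient T i‖ * ‖nodalGradient T k‖)
        = |δ i| * (cosMin T * (‖nodalGradient T i‖ * ‖nodalGradient T k‖)) := by ring
      _ ≤ |δ i| * -inner ℝ (nodalGradient T i) (nodalGradient T k) := by
        gcongr
        exact cosMin_mul_le_neg_inner_nodalGradient hik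
      _ = δ i * (σ * inner ℝ (nodalGradient T i) (nodalGradient T k)) := by
        rw [← hsign i hik]
        ring
  have hbound := (hA.isRadialField η).le_inner_sub hlam hT hdiff hacute
  simpa only [norm_smul, Real.norm_eq_abs, hnorm] using hbound

lemma mul_edgeVariation_mul_le_inner_flux_sub (hA : AdmissibleAt A b lam C K B x) (hlam : 0 ≤ lam)
    (hT : 0 ≤ cosMin T) (hC : C ≤ lam * cosMin T) (hx : x ∈ interior T.closedInterior)
    (hu₁ : AffineOn u₁ T.closedInterior) (hu₂ : AffineOn u₂ T.closedInterior)
    (hv : IsVertexIndicator T v (u₁ - u₂)) (hv' : AffineOn v T.closedInterior)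
    (hk : ∀ i ≠ k, v (T.points i) = 1 - v (T.points k)) {l : Fin 3}
    (hl : ∀ i ≠ k, ‖nodalGradient T l‖ ≤ ‖nodalGradient T i‖) (η : ℝ) :
    (lam * cosMin T - C)
        * (edgeVariation T (u₁ - u₂) k * ‖nodalGradient T l‖ * ‖nodalGradient T k‖)
      ≤ inner ℝ (flux A x η (gradient u₁ x) - flux A x η (gradient u₂ x)) (gradient v x) := by
  refine le_trans (mul_le_mul_of_nonneg_left ?_ (sub_nonneg.2 hC))
    (le_inner_flux_sub_of_lone hA hlam hT hx hu₁ hu₂ hv hv' hk η)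
  rw [edgeVariation, Finset.sum_mul]
  gcongr with i hi
  exact hl i (by simpa using hi)

lemma IsMeshFine.bound_le (hT : IsMeshFine lam C K B u₁ u₂ T) (hA : AdmissibleAt A b lam C K B x) :
    C ≤ lam * cosMin T := by
  have hK := hA.diffusion_bound_nonneg
  have hB := hA.reaction_bound_nonneg
  have hvar : 0 ≤ min (vertexVariation T u₁) (vertexVariation T u₂) :=
    le_min (vertexVariation_nonneg u₁) (vertexVariation_nonneg u₂)
  have hr : 0 < sinRatio T := sinRatio_pos
  have hs : 0 < sinMax T := sinMax_pos
  have harea : 0 ≤ area T := measureReal_nonneg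
  have hlow : 0 ≤ K * (min (vertexVariation T u₁) (vertexVariation T u₂) * (1 + (sinRatio T)⁻¹))
      + B * (2 * area T * sinMax T) := by positivity
  exact sub_nonneg.1 (hlow.trans hT.le)

lemma le_weakIntegrand_sub_of_lone (hA : AdmissibleAt A b lam C K B x) (hlam : 0 < lam)
    (hT : IsMeshFine lam C K B u₁ u₂ T) (hx : x ∈ interior T.closedInterior)
    (hu₁ : AffineOn u₁ T.closedInterior) (hu₂ : AffineOn u₂ T.closedInterior)
    (hv : IsVertexIndicator T v (u₁ - u₂)) (hv' : AffineOn v T.closedInterior)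
    (hk : ∀ i ≠ k, v (T.points i) = 1 - v (T.points k)) {l : Fin 3}
    (hl : ∀ i ≠ k, ‖nodalGradient T l‖ ≤ ‖nodalGradient T i‖) :
    edgeVariation T (u₁ - u₂) k * ((lam * cosMin T - C
        - K * (min (vertexVariation T u₁) (vertexVariation T u₂) * (1 + (sinRatio T)⁻¹)))
        * (‖nodalGradient T l‖ * ‖nodalGradient T k‖) - B)
      ≤ weakIntegrand A b u₁ v x - weakIntegrand A b u₂ v x := by
  have hxT := interior_subset hx
  have hC := hT.bound_le hA
  have hcos : 0 ≤ cosMin T :=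
    nonneg_of_mul_nonneg_right ((hA.isRadialField 0).bound_nonneg.trans hC) hlam
  have hK := hA.diffusion_bound_nonneg
  have hS : 0 < edgeVariation T (u₁ - u₂) k := hv.edgeVariation_pos hk
  have hgap : |u₁ x - u₂ x| ≤ edgeVariation T (u₁ - u₂) k :=
    hv.abs_le_edgeVariation hk (hu₁.sub hu₂) hxT
  set S := edgeVariation T (u₁ - u₂) k
  set D := min (vertexVariation T u₁) (vertexVariation T u₂) * (1 + (sinRatio T)⁻¹) with hD
  have hflux := hA.le_inner_flux_sub (η₁ := u₁ x) (η₂ := u₂ x) fun η =>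
    mul_edgeVariation_mul_le_inner_flux_sub hA hlam.le hcos hC hx hu₁ hu₂ hv hv' hk hl η
  have hreaction := hA.le_reaction_sub_mul (η₁ := u₁ x) (η₂ := u₂ x) (hv.mem_Icc hv' hxT)
  have hgrad : min ‖gradient u₁ x‖ ‖gradient u₂ x‖ ≤ D * ‖nodalGradient T l‖ := by
    have hr : 0 ≤ 1 + (sinRatio T)⁻¹ := by linarith [inv_pos.2 (sinRatio_pos (T := T))]
    rw [hD, min_mul_of_nonneg _ _ hr, min_mul_of_nonneg _ _ (norm_nonneg _)]
    exact min_le_min (norm_gradient_le hu₁ hx l) (norm_gradient_le hu₂ hx l)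
  have hlower : K * |u₁ x - u₂ x| * (min ‖gradient u₁ x‖ ‖gradient u₂ x‖ * ‖gradient v x‖)
      ≤ K * S * (D * ‖nodalGradient T l‖ * ‖nodalGradient T k‖) := by
    rw [hv.norm_gradient_eq hv' hk hx]
    gcongr
  have hreaction' := mul_le_mul_of_nonneg_left hgap hA.reaction_bound_nonneg
  rw [weakIntegrand_sub_weakIntegrand]
  linarith

lemma weakIntegrand_lt_of_lone (hA : AdmissibleAt A b lam C K B x) (hlam : 0 < lam)
    (hT : IsMeshFine lam C K B u₁ u₂ T) (hx : x ∈ interior T.closedInterior)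
    (hu₁ : AffineOn u₁ T.closedInterior) (hu₂ : AffineOn u₂ T.closedInterior)
    (hv : IsVertexIndicator T v (u₁ - u₂)) (hv' : AffineOn v T.closedInterior)
    (hk : ∀ i ≠ k, v (T.points i) = 1 - v (T.points k)) :
    weakIntegrand A b u₂ v x < weakIntegrand A b u₁ v x := by
  obtain ⟨l, hl, hmin⟩ := Finset.exists_min_image ({k}ᶜ : Finset (Fin 3))
    (fun i => ‖nodalGradient T i‖) ⟨k + 1, by simp⟩
  have hlow := le_weakIntegrand_sub_of_lone hA hlam hT hx hu₁ hu₂ hv hv' hk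
    fun i hi => hmin i (by simpa using hi)
  have hN : 0 < ‖nodalGradient T l‖ * ‖nodalGradient T k‖ :=
    mul_pos (norm_nodalGradient_pos l) (norm_nodalGradient_pos k)
  have hreaction := mul_le_mul_of_nonneg_left
    (one_le_two_mul_area_mul_sinMax_mul (T := T) (by simpa using hl : l ≠ k))
    hA.reaction_bound_nonneg
  have hfine := mul_lt_mul_of_pos_right hT hN
  refine sub_pos.1 ((mul_pos (hv.edgeVariation_pos hk) ?_).trans_le hlow)
  linarith

lemma weakIntegrand_le_of_forall_eq (hA : AdmissibleAt A b lam C K B x)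
    (hx : x ∈ interior T.closedInterior)
    (hu₁ : AffineOn u₁ T.closedInterior) (hu₂ : AffineOn u₂ T.closedInterior)
    (hv : IsVertexIndicator T v (u₁ - u₂)) (hv' : AffineOn v T.closedInterior)
    {m : ℝ} (hm : ∀ i, v (T.points i) = m) :
    weakIntegrand A b u₂ v x ≤ weakIntegrand A b u₁ v x := by
  have hxT := interior_subset hx
  have hgrad : gradient v x = 0 := by
    rw [gradient_eq_smul_nodalGradient hv' hx (k := 0) fun i _ => hm i, hm, sub_self, zero_smul]
  have hvx : v x = m := hv'.mapsTo_closedInterior (convex_singleton m) hm hxT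
  rw [← sub_nonneg, weakIntegrand_sub_weakIntegrand, hgrad, inner_zero_right, zero_add, hvx]
  rcases hv.eq_zero_or_eq_one 0 with h | h <;> rw [hm 0] at h <;> subst h
  · rw [mul_zero]
  · have hpos (i : Fin 3) : 0 < (u₁ - u₂) (T.points i) := by
      by_contra hneg
      have hvi := hm i
      rw [hv i, if_neg hneg] at hvi
      exact zero_ne_one hvi
    have hle : u₂ x ≤ u₁ x :=
      (sub_pos.1 ((hu₁.sub hu₂).mapsTo_closedInterior (convex_Ioi 0) hpos hxT)).le
    rw [mul_one]
    exact sub_nonneg.2 (hA.monotone hle)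

lemma weakIntegrand_le (hA : AdmissibleAt A b lam C K B x) (hlam : 0 < lam)
    (hT : IsMeshFine lam C K B u₁ u₂ T) (hx : x ∈ interior T.closedInterior)
    (hu₁ : AffineOn u₁ T.closedInterior) (hu₂ : AffineOn u₂ T.closedInterior)
    (hv : IsVertexIndicator T v (u₁ - u₂)) (hv' : AffineOn v T.closedInterior) :
    weakIntegrand A b u₂ v x ≤ weakIntegrand A b u₁ v x := by
  rcases forall_eq_or_exists_lone hv.eq_zero_or_eq_one with ⟨m, hm⟩ | ⟨k, hk⟩
  · exact weakIntegrand_le_of_forall_eq hA hx hu₁ hu₂ hv hv' hm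
  · exact (weakIntegrand_lt_of_lone hA hlam hT hx hu₁ hu₂ hv hv' hk).le

lemma exists_forall_eq_of_weakIntegrand_eq (hA : AdmissibleAt A b lam C K B x) (hlam : 0 < lam)
    (hT : IsMeshFine lam C K B u₁ u₂ T) (hx : x ∈ interior T.closedInterior)
    (hu₁ : AffineOn u₁ T.closedInterior) (hu₂ : AffineOn u₂ T.closedInterior)
    (hv : IsVertexIndicator T v (u₁ - u₂)) (hv' : AffineOn v T.closedInterior)
    (heq : weakIntegrand A b u₂ v x = weakIntegrand A b u₁ v x) :
    ∃ m, ∀ i, v (T.points i) = m :=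
  (forall_eq_or_exists_lone hv.eq_zero_or_eq_one).resolve_right fun ⟨_, hk⟩ =>
    (weakIntegrand_lt_of_lone hA hlam hT hx hu₁ hu₂ hv hv' hk).ne heq

end Triangle

/-! ### The mesh and the test function -/

section Mesh

lemma exists_affineMap_apply_points_eq (T : Affine.Triangle ℝ Plane) (c : Fin 3 → ℝ) :
    ∃ L : Plane →ᵃ[ℝ] ℝ, ∀ i, L (T.points i) = c i := by
  refine ⟨(Fintype.linearCombination ℝ c).toAffineMap.comp (vertexBasis T).coords, fun i => ?_⟩
  simp [Fintype.linearCombination_apply, ← vertexBasis_apply, AffineBasis.coord_apply]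

lemma eq_of_isClosed_cover {X Y ι : Type*} [TopologicalSpace X] [MetricSpace Y] [Finite ι]
    {s : ι → Set X} (hs : ∀ i, IsClosed (s i)) (hconn : IsPreconnected (⋃ i, s i)) {φ : X → Y}
    (hφ : ∀ i, ∃ m, ∀ x ∈ s i, φ x = m) {x y : X} (hx : x ∈ ⋃ i, s i) (hy : y ∈ ⋃ i, s i) :
    φ x = φ y := by
  choose m hm using hφ
  have hcont : ContinuousOn φ (⋃ i, s i) := (locallyFinite_of_finite s).continuousOn_iUnion hs
    fun i => continuousOn_const.congr (hm i)
  have hrange : φ '' (⋃ i, s i) ⊆ range m := by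
    rintro _ ⟨z, hz, rfl⟩
    obtain ⟨i, hi⟩ := mem_iUnion.1 hz
    exact ⟨i, (hm i z hi).symm⟩
  exact (finite_range m).countable.isTotallyDisconnected _ hrange (hconn.image φ hcont)
    (mem_image_of_mem φ hx) (mem_image_of_mem φ hy)

variable {Ω ΓD : Set Plane} {𝒯 : Finset (Affine.Triangle ℝ Plane)} {T : Affine.Triangle ℝ Plane}
  {v w : Plane → ℝ}

lemma IsTriangulation.exists_mem (h𝒯 : IsTriangulation Ω 𝒯) {x : Plane} (hx : x ∈ closure Ω) :
    ∃ T ∈ 𝒯, x ∈ T.closedInterior := by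
  simpa [h𝒯.cover] using hx

lemma IsTriangulation.closedInterior_subset (h𝒯 : IsTriangulation Ω 𝒯) (hT : T ∈ 𝒯) :
    T.closedInterior ⊆ closure Ω := by
  rw [h𝒯.cover]
  exact subset_biUnion_of_mem (u := fun T : Affine.Triangle ℝ Plane => T.closedInterior) hT

lemma IsTriangulation.eq_of_forall_exists (h𝒯 : IsTriangulation Ω 𝒯)
    (hv : ∀ T ∈ 𝒯, ∃ m, ∀ x ∈ T.closedInterior, v x = m) {x y : Plane} (hx : x ∈ closure Ω)
    (hy : y ∈ closure Ω) : v x = v y := by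
  have hcover : closure Ω = ⋃ T : 𝒯, T.1.closedInterior := by
    rw [h𝒯.cover, iUnion_subtype]
  have hconn := h𝒯.isConnected.isPreconnected.closure
  rw [hcover] at hx hy hconn
  exact eq_of_isClosed_cover (fun T : 𝒯 => T.1.isClosed_closedInterior) hconn
    (fun T => hv T.1 T.2) hx hy

lemma IsTriangulation.exists_interpolant (h𝒯 : IsTriangulation Ω 𝒯) (c : Plane → ℝ) :
    ∃ v : Plane → ℝ, (∀ T ∈ 𝒯, AffineOn v T.closedInterior) ∧
      ∀ T ∈ 𝒯, ∀ i, v (T.points i) = c (T.points i) := by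
  classical
  choose L hL using fun T => exists_affineMap_apply_points_eq T (c ∘ T.points)
  let v : Plane → ℝ := fun x => if h : ∃ T ∈ 𝒯, x ∈ T.closedInterior then L h.choose x else 0
  have hv : ∀ T ∈ 𝒯, ∀ x ∈ T.closedInterior, v x = L T x := by
    intro T hT x hx
    have h : ∃ T ∈ 𝒯, x ∈ T.closedInterior := ⟨T, hT, hx⟩
    have hcommon : EqOn (L h.choose) (L T) (range h.choose.points ∩ range T.points) := by
      rintro _ ⟨⟨i, rfl⟩, j, hj⟩
      rw [hL, ← hj, hL, Function.comp_apply, Function.comp_apply, hj]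
    have hx' : x ∈ convexHull ℝ (range h.choose.points ∩ range T.points) := by
      rw [← h𝒯.conforming _ h.choose_spec.1 T hT]
      exact ⟨h.choose_spec.2, hx⟩
    simp only [v, dif_pos h]
    exact AffineMap.eqOn_affineSpan hcommon (convexHull_subset_affineSpan _ hx')
  exact ⟨v, fun T hT => ⟨L T, hv T hT⟩, fun T hT i => by
    rw [hv T hT _ (T.point_mem_closedInterior i), hL, Function.comp_apply]⟩

lemma IsDirichletPart.mem_FESpace (hΓD : IsDirichletPart Ω 𝒯 ΓD)
    (hv : ∀ T ∈ 𝒯, AffineOn v T.closedInterior)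
    (hv₀ : ∀ T ∈ 𝒯, ∀ i, T.points i ∈ ΓD → v (T.points i) = 0) : v ∈ FESpace 𝒯 ΓD := by
  refine ⟨hv, fun x hx => ?_⟩
  obtain ⟨ℰ, hℰ, rfl⟩ := hΓD.captured
  obtain ⟨e, he, hxe⟩ := hx
  obtain ⟨-, T, hT, i, j, -, rfl⟩ := hℰ he
  have hends : {T.points i, T.points j} ⊆ range T.points :=
    insert_subset (mem_range_self i) (singleton_subset_iff.2 (mem_range_self j))
  have hedge : AffineOn v (convexHull ℝ {T.points i, T.points j}) :=
    (hv T hT).mono (T.convexHull_eq_closedInterior ▸ convexHull_mono hends)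
  have hvertex : ∀ p ∈ ({T.points i, T.points j} : Set Plane), v p ∈ ({0} : Set ℝ) := by
    rintro _ (rfl | rfl)
    · exact hv₀ T hT i ⟨_, he, left_mem_segment ℝ _ _⟩
    · exact hv₀ T hT j ⟨_, he, right_mem_segment ℝ _ _⟩
  rw [← convexHull_pair] at hxe
  exact hedge.mapsTo_convexHull (convex_singleton 0) hvertex hxe

lemma IsDirichletPart.exists_mem_closure (hΓD : IsDirichletPart Ω 𝒯 ΓD) :
    ∃ p ∈ closure Ω, p ∈ ΓD := by
  obtain ⟨p, hp⟩ := nonempty_of_measure_ne_zero hΓD.pos.ne'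
  obtain ⟨ℰ, hℰ, rfl⟩ := hΓD.captured
  obtain ⟨e, he, hpe⟩ := hp
  exact ⟨p, frontier_subset_closure ((hℰ he).1 hpe), e, he, hpe⟩

lemma exists_isVertexIndicator (h𝒯 : IsTriangulation Ω 𝒯) (hΓD : IsDirichletPart Ω 𝒯 ΓD)
    (hw : ∀ x ∈ ΓD, w x = 0) :
    ∃ v ∈ FESpaceNonneg Ω 𝒯 ΓD, ∀ T ∈ 𝒯, IsVertexIndicator T v w := by
  classical
  obtain ⟨v, hv, hvertex⟩ := h𝒯.exists_interpolant fun x => if 0 < w x then 1 else 0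
  refine ⟨v, ⟨hΓD.mem_FESpace hv fun T hT i hi => ?_, fun x hx => ?_⟩, hvertex⟩
  · rw [hvertex T hT i, hw _ hi, if_neg (lt_irrefl 0)]
  · obtain ⟨T, hT, hxT⟩ := h𝒯.exists_mem (subset_closure hx)
    have hv' : IsVertexIndicator T v w := hvertex T hT
    exact (hv'.mem_Icc (hv T hT) hxT).1

lemma IsTriangulation.ae_mem_interior (h𝒯 : IsTriangulation Ω 𝒯) :
    ∀ᵐ x ∂volume.restrict Ω, ∃ T ∈ 𝒯, x ∈ interior T.closedInterior := by
  have hfrontier : ∀ᵐ x ∂volume.restrict Ω, ∀ T ∈ 𝒯, x ∉ frontier T.closedInterior :=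
    (Filter.eventually_all_finset 𝒯).2 fun T _ => ae_restrict_of_ae
      (measure_eq_zero_iff_ae_notMem.1 ((convex_closedInterior T).addHaar_frontier volume))
  filter_upwards [hfrontier, ae_restrict_mem h𝒯.isOpen.measurableSet] with x hx hxΩ
  obtain ⟨T, hT, hxT⟩ := h𝒯.exists_mem (subset_closure hxΩ)
  exact ⟨T, hT, by_contra fun hi => hx T hT ⟨subset_closure hxT, hi⟩⟩

lemma IsTriangulation.frequently_mem_interior (h𝒯 : IsTriangulation Ω 𝒯) (hT : T ∈ 𝒯) :
    ∃ᵐ x ∂volume.restrict Ω, x ∈ interior T.closedInterior := by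
  obtain ⟨y, hy⟩ : (interior T.closedInterior).Nonempty := by
    rw [← T.convexHull_eq_closedInterior, interior_convexHull_nonempty_iff_affineSpan_eq_top]
    exact (vertexBasis T).tot
  have hmeet : (interior T.closedInterior ∩ Ω).Nonempty :=
    mem_closure_iff.1 (h𝒯.closedInterior_subset hT (interior_subset hy)) _ isOpen_interior hy
  rw [Filter.Frequently, ← measure_eq_zero_iff_ae_notMem,
    Measure.restrict_apply isOpen_interior.measurableSet]
  exact ((isOpen_interior.inter h𝒯.isOpen).measure_pos volume hmeet).ne'

end Mesh

section Comparison

variable {Ω ΓD : Set Plane} {𝒯 : Finset (Affine.Triangle ℝ Plane)} {A : Plane → ℝ → Plane → ℝ}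
  {b : Plane → ℝ → ℝ} {lam C K B : ℝ} {u₁ u₂ v : Plane → ℝ}

/-- `u₁` and `u₂` satisfy the weak inequality between a discrete subsolution and a discrete
supersolution; the right hand side of the weak form has dropped out. -/
structure WeaklyLE (Ω : Set Plane) (𝒯 : Finset (Affine.Triangle ℝ Plane)) (ΓD : Set Plane)
    (A : Plane → ℝ → Plane → ℝ) (b : Plane → ℝ → ℝ) (u₁ u₂ : Plane → ℝ) : Prop where
  left_mem : u₁ ∈ FESpace 𝒯 ΓD
  right_mem : u₂ ∈ FESpace 𝒯 ΓD
  integrableOn_left : ∀ v ∈ FESpaceNonneg Ω 𝒯 ΓD, IntegrableOn (weakIntegrand A b u₁ v) Ω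
  integrableOn_right : ∀ v ∈ FESpaceNonneg Ω 𝒯 ΓD, IntegrableOn (weakIntegrand A b u₂ v) Ω
  integral_le : ∀ v ∈ FESpaceNonneg Ω 𝒯 ΓD,
    ∫ x in Ω, weakIntegrand A b u₁ v x ≤ ∫ x in Ω, weakIntegrand A b u₂ v x

lemma WeaklyLE.ae_weakIntegrand_eq (hu : WeaklyLE Ω 𝒯 ΓD A b u₁ u₂) (h𝒯 : IsTriangulation Ω 𝒯)
    (hlam : 0 < lam) (hA : ∀ᵐ x ∂volume.restrict Ω, AdmissibleAt A b lam C K B x)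
    (hfine : ∀ T ∈ 𝒯, IsMeshFine lam C K B u₁ u₂ T) (hv : v ∈ FESpaceNonneg Ω 𝒯 ΓD)
    (hvw : ∀ T ∈ 𝒯, IsVertexIndicator T v (u₁ - u₂)) :
    weakIntegrand A b u₂ v =ᵐ[volume.restrict Ω] weakIntegrand A b u₁ v := by
  have hint₁ := hu.integrableOn_left v hv
  have hint₂ := hu.integrableOn_right v hv
  have hle : weakIntegrand A b u₂ v ≤ᵐ[volume.restrict Ω] weakIntegrand A b u₁ v := by
    filter_upwards [hA, h𝒯.ae_mem_interior] with x hAx ⟨T, hT, hx⟩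
    exact weakIntegrand_le hAx hlam (hfine T hT) hx (hu.left_mem.1 T hT) (hu.right_mem.1 T hT)
      (hvw T hT) (hv.1.1 T hT)
  exact (integral_eq_iff_of_ae_le hint₂ hint₁ hle).1
    (le_antisymm (integral_mono_ae hint₂ hint₁ hle) (hu.integral_le v hv))

lemma WeaklyLE.eq_zero_of_isVertexIndicator (hu : WeaklyLE Ω 𝒯 ΓD A b u₁ u₂)
    (h𝒯 : IsTriangulation Ω 𝒯) (hΓD : IsDirichletPart Ω 𝒯 ΓD) (hlam : 0 < lam)
    (hA : ∀ᵐ x ∂volume.restrict Ω, AdmissibleAt A b lam C K B x)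
    (hfine : ∀ T ∈ 𝒯, IsMeshFine lam C K B u₁ u₂ T) (hv : v ∈ FESpaceNonneg Ω 𝒯 ΓD)
    (hvw : ∀ T ∈ 𝒯, IsVertexIndicator T v (u₁ - u₂)) {x : Plane} (hx : x ∈ closure Ω) :
    v x = 0 := by
  have heq := hu.ae_weakIntegrand_eq h𝒯 hlam hA hfine hv hvw
  have hconst : ∀ T ∈ 𝒯, ∃ m, ∀ x ∈ T.closedInterior, v x = m := by
    intro T hT
    obtain ⟨y, hy, hAy, heqy⟩ :=
      ((h𝒯.frequently_mem_interior hT).and_eventually (hA.and heq)).exists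
    obtain ⟨m, hm⟩ := exists_forall_eq_of_weakIntegrand_eq hAy hlam (hfine T hT) hy
      (hu.left_mem.1 T hT) (hu.right_mem.1 T hT) (hvw T hT) (hv.1.1 T hT) heqy
    have hvT : AffineOn v T.closedInterior := hv.1.1 T hT
    exact ⟨m, hvT.mapsTo_closedInterior (convex_singleton m) hm⟩
  obtain ⟨p, hp, hpD⟩ := hΓD.exists_mem_closure
  rw [h𝒯.eq_of_forall_exists hconst hx hp, hv.1.2 p hpD]

lemma WeaklyLE.le_on (hu : WeaklyLE Ω 𝒯 ΓD A b u₁ u₂) (h𝒯 : IsTriangulation Ω 𝒯)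
    (hΓD : IsDirichletPart Ω 𝒯 ΓD) (hlam : 0 < lam)
    (hA : ∀ᵐ x ∂volume.restrict Ω, AdmissibleAt A b lam C K B x)
    (hfine : ∀ T ∈ 𝒯, IsMeshFine lam C K B u₁ u₂ T) :
    ∀ x ∈ Ω, u₁ x ≤ u₂ x := by
  have hw : ∀ x ∈ ΓD, (u₁ - u₂) x = 0 := fun x hx => by
    rw [Pi.sub_apply, hu.left_mem.2 x hx, hu.right_mem.2 x hx, sub_zero]
  obtain ⟨v, hv, hvw⟩ := exists_isVertexIndicator h𝒯 hΓD hw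
  intro x hx
  obtain ⟨T, hT, hxT⟩ := h𝒯.exists_mem (subset_closure hx)
  have hvertex (i : Fin 3) : (u₁ - u₂) (T.points i) ∈ Iic 0 := by
    by_contra hpos
    have hvi := hvw T hT i
    rw [hu.eq_zero_of_isVertexIndicator h𝒯 hΓD hlam hA hfine hv hvw
      (h𝒯.closedInterior_subset hT (T.point_mem_closedInterior i)), if_pos (not_le.1 hpos)] at hvi
    exact zero_ne_one hvi
  have hu₁ : AffineOn u₁ T.closedInterior := hu.left_mem.1 T hT
  exact sub_nonpos.1 ((hu₁.sub (hu.right_mem.1 T hT)).mapsTo_closedInterior (convex_Iic 0)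
    hvertex hxT)

end Comparison

/-! ### The assumptions of the theorem -/

section Assumptions

variable {Ω ΓD : Set Plane} {𝒯 : Finset (Affine.Triangle ℝ Plane)} {A : Plane → ℝ → Plane → ℝ}
  {b : Plane → ℝ → ℝ} {A₀ A₁ : Plane → ℝ → ℝ} {A₂ : Plane → ℝ} {f g : ℝ → ℝ}
  {γa Kη Bη lam₀ Λ₁ Λ₂ Cf Cg : ℝ} {ψ u u₁ u₂ : Plane → ℝ}

lemma abs_sub_le_of_abs_deriv_le {φ : ℝ → ℝ} {K : ℝ} (hφ : Differentiable ℝ φ)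
    (hK : ∀ t, |deriv φ t| ≤ K) (s t : ℝ) : |φ s - φ t| ≤ K * |s - t| :=
  convex_univ.norm_image_sub_le_of_norm_deriv_le (fun t _ => hφ t) (fun t _ => hK t) (mem_univ t)
    (mem_univ s)

lemma mul_abs_deriv_add_le {a₀ a₁ a₂ Cf Cg s : ℝ} (ha₁ : a₁ ∈ Icc 0 Λ₁) (ha₂ : a₂ ∈ Icc 0 Λ₂)
    (hs : 0 ≤ s) (hf : DifferentiableAt ℝ f s) (hg : DifferentiableAt ℝ g s)
    (hf' : s * |deriv f s| ≤ Cf) (hg' : s * |deriv g s| ≤ Cg) :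
    DifferentiableAt ℝ (fun s => a₀ + a₁ * f s + a₂ * g s) s ∧
      s * |deriv (fun s => a₀ + a₁ * f s + a₂ * g s) s| ≤ Λ₁ * Cf + Λ₂ * Cg := by
  have hderiv : HasDerivAt (fun s => a₀ + a₁ * f s + a₂ * g s)
      (a₁ * deriv f s + a₂ * deriv g s) s :=
    ((hf.hasDerivAt.const_mul a₁).const_add a₀).add (hg.hasDerivAt.const_mul a₂)
  refine ⟨hderiv.differentiableAt, ?_⟩
  calc s * |deriv (fun s => a₀ + a₁ * f s + a₂ * g s) s|
      ≤ s * (|a₁ * deriv f s| + |a₂ * deriv g s|) := by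
        rw [hderiv.deriv]
        gcongr
        exact abs_add_le _ _
    _ = a₁ * (s * |deriv f s|) + a₂ * (s * |deriv g s|) := by
        rw [abs_mul, abs_mul, abs_of_nonneg ha₁.1, abs_of_nonneg ha₂.1]
        ring
    _ ≤ Λ₁ * Cf + Λ₂ * Cg :=
        add_le_add (mul_le_mul ha₁.2 hf' (by positivity) (ha₁.1.trans ha₁.2))
          (mul_le_mul ha₂.2 hg' (by positivity) (ha₂.1.trans ha₂.2))

lemma DiffusionForm.ae_isRadialField (hform : DiffusionForm Ω A A₀ A₁ A₂ f g lam₀ Λ₁ Λ₂ Cf Cg)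
    (hcoeff : CoefficientAssumptions Ω A b γa Kη Bη) (hΩ : MeasurableSet Ω) :
    ∀ᵐ x ∂volume.restrict Ω, ∀ η, IsRadialField (flux A x η) lam₀ (Λ₁ * Cf + Λ₂ * Cg) := by
  filter_upwards [hcoeff.flux_contDiff, hform.A₀_bound, hform.A₁_bound, hform.A₂_bound,
    ae_restrict_mem hΩ] with x hflux hA₀ hA₁ hA₂ hx η
  refine ⟨hflux.comp (contDiff_const.prodMk contDiff_id),
    fun s => A₀ x η + A₁ x η * f s + A₂ x * g s, fun ξ => ?_, fun s hs => ?_, fun s hs => ?_⟩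
  · rw [flux, hform.decomp x hx]
  · linarith [hA₀ η, mul_nonneg (hA₁ η).1 (hform.f_nonneg s hs),
      mul_nonneg hA₂.1 (hform.g_nonneg s hs)]
  · exact mul_abs_deriv_add_le (hA₁ η) hA₂ hs.le (hform.f_differentiable s hs)
      (hform.g_differentiable s hs) (hform.f_deriv s hs.le) (hform.g_deriv s hs.le)

lemma CoefficientAssumptions.ae_admissibleAt (hcoeff : CoefficientAssumptions Ω A b γa Kη Bη)
    (hform : DiffusionForm Ω A A₀ A₁ A₂ f g lam₀ Λ₁ Λ₂ Cf Cg) (hΩ : MeasurableSet Ω) :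
    ∀ᵐ x ∂volume.restrict Ω, AdmissibleAt A b lam₀ (Λ₁ * Cf + Λ₂ * Cg) Kη Bη x := by
  filter_upwards [hform.ae_isRadialField hcoeff hΩ, hcoeff.A_deriv, hcoeff.b_contDiff,
    hcoeff.b_deriv] with x hradial hA hb hb'
  have hbdiff : Differentiable ℝ (b x) := hb.differentiable one_ne_zero
  exact
    { isRadialField := hradial
      abs_diffusion_sub_le := fun η₁ η₂ ξ =>
        abs_sub_le_of_abs_deriv_le (fun η => (hA η ξ).1) (fun η => (hA η ξ).2) η₁ η₂
      monotone := monotone_of_deriv_nonneg hbdiff fun η => (hb' η).1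
      abs_reaction_sub_le := abs_sub_le_of_abs_deriv_le hbdiff fun η =>
        (abs_of_nonneg (hb' η).1).trans_le (hb' η).2 }

lemma MeshCondition.isMeshFine (hM : MeshCondition 𝒯 lam₀ Λ₁ Λ₂ Cf Cg γa Kη Bη u)
    (hK : 0 ≤ Kη) (hB : 0 ≤ Bη) (hu : u = u₁ ∨ u = u₂) :
    ∀ T ∈ 𝒯, IsMeshFine lam₀ (Λ₁ * Cf + Λ₂ * Cg) Kη Bη u₁ u₂ T := by
  intro T hT
  have hr : 0 < sinRatio T := sinRatio_pos
  have hs : 0 < sinMax T := sinMax_pos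
  have harea : 0 ≤ area T := measureReal_nonneg
  have hvar : min (vertexVariation T u₁) (vertexVariation T u₂) ≤ vertexVariation T u := by
    rcases hu with rfl | rfl
    exacts [min_le_left _ _, min_le_right _ _]
  have hvar₀ : 0 ≤ vertexVariation T u := vertexVariation_nonneg u
  have hdiffusion : Kη * (min (vertexVariation T u₁) (vertexVariation T u₂) * (1 + (sinRatio T)⁻¹))
      ≤ Kη * (vertexVariation T u * (1 + (sinRatio T)⁻¹)) := by gcongr
  have hdiffusion₀ : 0 ≤ Kη * (vertexVariation T u * (1 + (sinRatio T)⁻¹)) := by positivity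
  have hreaction₀ : 0 ≤ Bη * (area T * sinMax T) := by positivity
  have hstar : pStar lam₀ Λ₁ Λ₂ Cf Cg γa T ≤ lam₀ * cosMin T - Λ₁ * Cf - Λ₂ * Cg := min_le_left _ _
  have hMT := hM T hT
  unfold IsMeshFine
  linarith

lemma IsSubsolution.weaklyLE (h₁ : IsSubsolution Ω 𝒯 ΓD A b ψ u₁)
    (h₂ : IsSupersolution Ω 𝒯 ΓD A b ψ u₂) : WeaklyLE Ω 𝒯 ΓD A b u₁ u₂ where
  left_mem := h₁.1
  right_mem := h₂.1
  integrableOn_left v hv := (h₁.2 v hv).1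
  integrableOn_right v hv := (h₂.2 v hv).1
  integral_le v hv := (sub_nonpos.1 (h₁.2 v hv).2).trans (sub_nonneg.1 (h₂.2 v hv).2)

lemma IsDiscreteSolution.isSubsolution (hu : IsDiscreteSolution Ω 𝒯 ΓD A b ψ u) :
    IsSubsolution Ω 𝒯 ΓD A b ψ u :=
  ⟨hu.1, fun v hv => (hu.2 v hv.1).imp_right le_of_eq⟩

lemma IsDiscreteSolution.isSupersolution (hu : IsDiscreteSolution Ω 𝒯 ΓD A b ψ u) :
    IsSupersolution Ω 𝒯 ΓD A b ψ u :=
  ⟨hu.1, fun v hv => (hu.2 v hv.1).imp_right ge_of_eq⟩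

end Assumptions

end P1Comparison

theorem theorem4p5_general {Ω ΓD : Set Plane} {𝒯 : Finset (Affine.Triangle ℝ Plane)}
    {A : Plane → ℝ → Plane → ℝ} {b : Plane → ℝ → ℝ} {lam C K B : ℝ} {ψ : Plane → ℝ}
    (h𝒯 : IsTriangulation Ω 𝒯) (hΓD : IsDirichletPart Ω 𝒯 ΓD) (hlam : 0 < lam)
    (hA : ∀ᵐ x ∂volume.restrict Ω, AdmissibleAt A b lam C K B x) :
    (∀ u₁ u₂ : Plane → ℝ, IsSubsolution Ω 𝒯 ΓD A b ψ u₁ → IsSupersolution Ω 𝒯 ΓD A b ψ u₂ →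
      (∀ T ∈ 𝒯, IsMeshFine lam C K B u₁ u₂ T) → ∀ x ∈ Ω, u₁ x ≤ u₂ x) ∧
    (∀ u u' : Plane → ℝ, IsDiscreteSolution Ω 𝒯 ΓD A b ψ u → IsDiscreteSolution Ω 𝒯 ΓD A b ψ u' →
      (∀ T ∈ 𝒯, IsMeshFine lam C K B u u' T) → ∀ x ∈ Ω, u' x = u x) := by
  have hle (u₁ u₂ : Plane → ℝ) (h₁ : IsSubsolution Ω 𝒯 ΓD A b ψ u₁)
      (h₂ : IsSupersolution Ω 𝒯 ΓD A b ψ u₂) (hfine : ∀ T ∈ 𝒯, IsMeshFine lam C K B u₁ u₂ T) :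
      ∀ x ∈ Ω, u₁ x ≤ u₂ x :=
    (h₁.weaklyLE h₂).le_on h𝒯 hΓD hlam hA hfine
  refine ⟨hle, fun u u' hu hu' hfine x hx => le_antisymm ?_ ?_⟩
  · exact hle u' u hu'.isSubsolution hu.isSupersolution (fun T hT => (hfine T hT).symm) x hx
  · exact hle u u' hu.isSubsolution hu'.isSupersolution hfine x hx

theorem theorem4p5
    (Ω : Set Plane) (𝒯 : Finset (Affine.Triangle ℝ Plane)) (ΓD : Set Plane)
    (h𝒯 : IsTriangulation Ω 𝒯) (hΓD : IsDirichletPart Ω 𝒯 ΓD)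
    (tmin tmax : ℝ) (hreg : MeshRegular 𝒯 tmin tmax)
    (A : Plane → ℝ → Plane → ℝ) (b : Plane → ℝ → ℝ) (γa Kη Bη : ℝ)
    (hcoeff : CoefficientAssumptions Ω A b γa Kη Bη)
    (A₀ A₁ : Plane → ℝ → ℝ) (A₂ : Plane → ℝ) (f g : ℝ → ℝ) (lam₀ Λ₁ Λ₂ Cf Cg : ℝ)
    (hform : DiffusionForm Ω A A₀ A₁ A₂ f g lam₀ Λ₁ Λ₂ Cf Cg)
    (ψ : Plane → ℝ) (hψ_meas : AEMeasurable ψ (μH[1].restrict (frontier Ω \ ΓD)))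
    (hψ_bdd : ∃ C : ℝ, ∀ x ∈ frontier Ω \ ΓD, |ψ x| ≤ C)
    (hpos : 0 < lam₀ * Real.cos tmax - Λ₁ * Cf - Λ₂ * Cg) :
    -- the comparison principle
    (∀ u₁ u₂ : Plane → ℝ, IsSubsolution Ω 𝒯 ΓD A b ψ u₁ → IsSupersolution Ω 𝒯 ΓD A b ψ u₂ →
      MeshCondition 𝒯 lam₀ Λ₁ Λ₂ Cf Cg γa Kη Bη u₂ → ∀ x ∈ Ω, u₁ x ≤ u₂ x) ∧
    -- uniqueness of the discrete solution
    (∀ u u' : Plane → ℝ, IsDiscreteSolution Ω 𝒯 ΓD A b ψ u → IsDiscreteSolution Ω 𝒯 ΓD A b ψ u' →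
      MeshCondition 𝒯 lam₀ Λ₁ Λ₂ Cf Cg γa Kη Bη u → ∀ x ∈ Ω, u' x = u x) := by
  have hgeneral := theorem4p5_general (ψ := ψ) h𝒯 hΓD hform.lam₀_pos
    (hcoeff.ae_admissibleAt hform h𝒯.isOpen.measurableSet)
  exact ⟨fun u₁ u₂ h₁ h₂ hM =>
      hgeneral.1 u₁ u₂ h₁ h₂ (hM.isMeshFine hcoeff.Kη_pos.le hcoeff.Bη_nonneg (Or.inr rfl)),
    fun u u' hu hu' hM =>
      hgeneral.2 u u' hu hu' (hM.isMeshFine hcoeff.Kη_pos.le hcoeff.Bη_nonneg (Or.inl rfl))⟩
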